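/- Let $\mathbb{F}\in\{\mathbb{R},\mathbb{C}\}$ and let $\mathfrak{g}$ be a nilpotent seven-dimensional $\mathbb{F}$-Lie algebra with a six-dimensional abelian ideal $\mathfrak{u}$. Then: (a) If $\mathbb{F}=\mathbb{R}$, then for every $e_7\in\mathfrak{g}\setminus\mathfrak{u}$: $\mathfrak{g}$ admits a cocalibrated $G_2$-structure if and only if the multiset of sizes of the Jordan blocks in the complex Jordan normal form of $\mathrm{ad}(e_7)|_{\mathfrak{u}}$ is none of $(5,1)$, $(3,2,1)$, $(3,1,1,1)$. (b) If $\mathbb{F}=\mathbb{R}$, then $\mathfrak{g}$ admits a cocalibrated $G_2^*$-structure. (c) If $\mathbb{F}=\mathbb{C}$, then $\mathfrak{g}$ admits a cocalibrated $(G_2)_{\mathbb{C}}$-structure. Here, writing $e^1,\dots,e^7$ for the dual basis of a basis $e_1,\dots,e_7$ of $\mathfrak{g}$, $e^{ijk}=e^i\wedge e^j\wedge e^k$ and $$\varphi_\varepsilon=\varepsilon e^{127}+\varepsilon e^{347}+e^{567}+e^{135}-e^{146}-e^{236}-e^{245},$$ a $G_2$-structure (respectively a $G_2^*$-structure) on a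 real $\mathfrak{g}$ is a three-form $\varphi\in\Lambda^3\mathfrak{g}^*$ that equals $\varphi_{1}$ (respectively $\varphi_{-1}$) for some basis, called adapted. It induces a unique (pseudo-)Euclidean metric $g$ and volume form $\mathrm{vol}$ such that $g(v,w)\,\mathrm{vol}=\tfrac16 (v\lrcorner\varphi)\wedge(w\lrcorner\varphi)\wedge\varphi$ for all $v,w$ and such that every adapted basis is orthonormal with $\mathrm{vol}=e^{1\cdots7}$ and $g(e_i,e_i)=\varepsilon$ for $i\le 4$, $g(e_i,e_i)=1$ for $i\ge5$. A $(G_2)_{\mathbb{C}}$-structure on a complex $\mathfrak{g}$ is a pair $(\varphi,\mathrm{vol})\in\Lambda^3\mathfrak{g}^*\times\Lambda^7\mathfrak{g}^*$ with $\varphi=\varphi_1$ and $\mathrm{vol}=e^{1\cdots 7}$ for some complex basis; it induces a complex bilinear form $g$ by the same identity. The Hodge dual $\star_\varphi\varphi$ is the four-form with $\varphi\wedge\xi=g(\star_\varphi\varphi,\xi)\,\mathrm{vol}$ for all four-forms $\xi$, where $g$ is extended to four-forms in the usual way. The structure is cocalibrated if $d(\star_\varphi\varphi)=0$, where $d$ is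 the degree-one antiderivation of $\Lambda^*\mathfrak{g}^*$ determined by $(d\alpha)(X,Y)=-\alpha([X,Y])$ for one-forms $\alpha$. -/

import Mathlib

open scoped TensorProduct

namespace CocalibratedG2

noncomputable section

/-! ### Exterior forms on a vector space -/

/-- `Form K V k` is the space `Λᵏ V*` of alternating `k`-forms on `V`. -/
abbrev Form (K V : Type*) [Field K] [AddCommGroup V] [Module K V] (k : ℕ) : Type _ :=
  V [⋀^Fin k]→ₗ[K] K

section Forms

variable {K V : Type*} [Field K] [AddCommGroup V] [Module K V]

/-- The wedge product `α ∧ β`: the sum over all `(k, l)`-shuffles, with signs, so that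
`(α ∧ β)(x, y) = α x * β y - α y * β x` for one-forms. -/
def wedge {k l : ℕ} (α : Form K V k) (β : Form K V l) : Form K V (k + l) :=
  ((LinearMap.mul' K K).compAlternatingMap (α.domCoprod β)).domDomCongr finSumFinEquiv

/-- The contraction `v ⌟ ω = ω(v, ⋯)`. -/
def contract {k : ℕ} (v : V) (ω : Form K V (k + 1)) : Form K V k :=
  ω.curryLeft v

/-- The decomposable form `α₀ ∧ ⋯ ∧ αₖ₋₁`, i.e. `(x₀, …, xₖ₋₁) ↦ det (αₐ (x_b))`. -/
def decomposable {k : ℕ} (α : Fin k → Module.Dual K V) : Form K V k :=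
  Matrix.detRowAlternating.compLinearMap (LinearMap.pi α)

/-- The form `e^{i₁} ∧ ⋯ ∧ e^{iₖ}`, where `e^i` is the dual basis of the basis `e`. The seven
indices run through `0, …, 6`, so that `e^{127}` of the usual notation is
`coordForm e ![0, 1, 6]`. -/
def coordForm {k : ℕ} (e : Module.Basis (Fin 7) K V) (I : Fin k → Fin 7) : Form K V k :=
  decomposable fun a => e.coord (I a)

/-- The volume form `e^{1234567}`. -/
def basisVolume (e : Module.Basis (Fin 7) K V) : Form K V 7 :=
  coordForm e ![0, 1, 2, 3, 4, 5, 6]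

/-! ### The standard three-forms -/

/-- `ε e^{127} + ε e^{347} + e^{567} + e^{135} - e^{146} - e^{236} - e^{245}`; the value `ε = 1`
is used for `G₂` and `(G₂)_ℂ`, the value `ε = -1` for `G₂*`. (Indices `1, …, 7` here, `0, …, 6`
in the code.) -/
def standardForm (ε : K) (e : Module.Basis (Fin 7) K V) : Form K V 3 :=
  ε • coordForm e ![0, 1, 6] + ε • coordForm e ![2, 3, 6] + coordForm e ![4, 5, 6]
    + coordForm e ![0, 2, 4] - coordForm e ![0, 3, 5] - coordForm e ![1, 2, 5]
    - coordForm e ![1, 3, 4]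

/-- The identity `g(v, w) vol = (1/6) (v ⌟ φ) ∧ (w ⌟ φ) ∧ φ` linking a three-form `φ` to the
bilinear form `g` and the volume form `vol`. -/
def MetricIdentity (φ : Form K V 3) (g : LinearMap.BilinForm K V) (vol : Form K V 7) : Prop :=
  ∀ v w : V, g v w • vol = (1 / 6 : K) • wedge (wedge (contract v φ) (contract w φ)) φ

/-! ### The Hodge star -/

/-- `G` is the bilinear form induced by the (non-degenerate, symmetric) bilinear form `g` on
`k`-forms, i.e. `G (α₁ ∧ ⋯ ∧ αₖ) (β₁ ∧ ⋯ ∧ βₖ) = det (g⁻¹ (αₐ, β_b))`. Writing `βₐ = g(yₐ, ·)`,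
this says that `G χ (β₁ ∧ ⋯ ∧ βₖ) = χ(y₁, …, yₖ)` for every `k`-form `χ`. -/
def IsInducedOnForms (g : LinearMap.BilinForm K V) {k : ℕ}
    (G : LinearMap.BilinForm K (Form K V k)) : Prop :=
  ∀ (χ : Form K V k) (y : Fin k → V), G χ (decomposable fun a => g (y a)) = χ y

/-- `χ` is the Hodge dual `⋆ψ` of the three-form `ψ` with respect to `g` and `vol`:
`ψ ∧ ξ = g(χ, ξ) vol` for all four-forms `ξ`, where `g` also denotes the bilinear form induced
on four-forms. -/
def IsHodgeDual (g : LinearMap.BilinForm K V) (vol : Form K V 7) (ψ : Form K V 3)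
    (χ : Form K V 4) : Prop :=
  ∃ G : LinearMap.BilinForm K (Form K V 4), IsInducedOnForms g G ∧
    ∀ ξ : Form K V 4, wedge ψ ξ = G χ ξ • vol

end Forms

/-! ### `G₂`- and `G₂*`-structures on real vector spaces -/

section Real

variable {V : Type*} [AddCommGroup V] [Module ℝ V]

/-- `e` is an adapted basis for `φ`, where `ε = 1` for `G₂` and `ε = -1` for `G₂*`. -/
def IsAdaptedBasis (ε : ℝ) (φ : Form ℝ V 3) (e : Module.Basis (Fin 7) ℝ V) : Prop :=
  φ = standardForm ε e

/-- `φ` is a `G₂`-structure on `V`. -/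
def IsG2Structure (φ : Form ℝ V 3) : Prop := ∃ e, IsAdaptedBasis 1 φ e

/-- `φ` is a `G₂*`-structure on `V`. -/
def IsG2StarStructure (φ : Form ℝ V 3) : Prop := ∃ e, IsAdaptedBasis (-1) φ e

/-- `(g, vol)` is the (pseudo-)Euclidean metric together with the metric volume form induced by
`φ`: they satisfy the metric identity, and each adapted basis is an oriented orthonormal basis
(with `g(eᵢ, eᵢ) = ε` for `i = 1, …, 4` and `g(eᵢ, eᵢ) = 1` for `i = 5, 6, 7`). -/
structure IsInducedMetric (ε : ℝ) (φ : Form ℝ V 3) (g : LinearMap.BilinForm ℝ V)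
    (vol : Form ℝ V 7) : Prop where
  metricIdentity : MetricIdentity φ g vol
  oriented : ∀ e, IsAdaptedBasis ε φ e → vol = basisVolume e
  orthonormal : ∀ e, IsAdaptedBasis ε φ e → ∀ i j : Fin 7,
    g (e i) (e j) = if i = j then (if (i : ℕ) < 4 then ε else 1) else 0

end Real

/-! ### `(G₂)_ℂ`-structures on complex vector spaces -/

section Complex

variable {W : Type*} [AddCommGroup W] [Module ℂ W]

/-- `(φ, vol)` is a `(G₂)_ℂ`-structure on `W`. -/
def IsComplexG2Structure (φ : Form ℂ W 3) (vol : Form ℂ W 7) : Prop :=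
  ∃ E : Module.Basis (Fin 7) ℂ W, vol = basisVolume E ∧ φ = standardForm 1 E

end Complex

/-! ### The exterior derivative of a Lie algebra and cocalibrated structures -/

section LieAlg

variable {K L : Type*} [Field K] [LieRing L] [LieAlgebra K L]

/-- The value `(dω)(X₀, …, Xₙ₊₁)` of the exterior derivative of a left-invariant
`(n + 1)`-form `ω`:
`∑_{i < j} (-1)^{i + j} ω([Xᵢ, Xⱼ], X₀, …, X̂ᵢ, …, X̂ⱼ, …, Xₙ₊₁)`.
The pair `(i, j)` of indices with `i ≤ j` below stands for the pair `(i, j + 1)` in this formula,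
which accounts for the minus sign. For one-forms, `(dα)(X, Y) = -α([X, Y])`. -/
def lieDeriv {n : ℕ} (ω : Form K L (n + 1)) (X : Fin (n + 2) → L) : K :=
  -∑ i : Fin (n + 1), ∑ j ∈ Finset.Ici i, (-1 : K) ^ ((i : ℕ) + (j : ℕ)) *
    ω (Matrix.vecCons ⁅X i.castSucc, X j.succ⁆ (j.removeNth (i.castSucc.removeNth X)))

/-- `dω = 0`. -/
def IsClosedForm {n : ℕ} (ω : Form K L (n + 1)) : Prop :=
  ∀ X : Fin (n + 2) → L, lieDeriv ω X = 0

end LieAlg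

section Admits

/-- The real Lie algebra `L` admits a cocalibrated `G₂`-structure: a `G₂`-structure `φ` with
`d ⋆_φ φ = 0`. -/
def AdmitsCocalibratedG2 (L : Type*) [LieRing L] [LieAlgebra ℝ L] : Prop :=
  ∃ (φ : Form ℝ L 3) (g : LinearMap.BilinForm ℝ L) (vol : Form ℝ L 7) (χ : Form ℝ L 4),
    IsG2Structure φ ∧ IsInducedMetric 1 φ g vol ∧ IsHodgeDual g vol φ χ ∧ IsClosedForm χ

/-- The real Lie algebra `L` admits a cocalibrated `G₂*`-structure: a `G₂*`-structure `φ` with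
`d ⋆_φ φ = 0`. -/
def AdmitsCocalibratedG2Star (L : Type*) [LieRing L] [LieAlgebra ℝ L] : Prop :=
  ∃ (φ : Form ℝ L 3) (g : LinearMap.BilinForm ℝ L) (vol : Form ℝ L 7) (χ : Form ℝ L 4),
    IsG2StarStructure φ ∧ IsInducedMetric (-1) φ g vol ∧ IsHodgeDual g vol φ χ ∧ IsClosedForm χ

/-- The complex Lie algebra `L` admits a cocalibrated `(G₂)_ℂ`-structure: a `(G₂)_ℂ`-structure
`(φ, vol)` with `d ⋆_φ φ = 0`. Here `vol ≠ 0` is part of the structure, so that the metric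
identity determines `g`. -/
def AdmitsCocalibratedComplexG2 (L : Type*) [LieRing L] [LieAlgebra ℂ L] : Prop :=
  ∃ (φ : Form ℂ L 3) (vol : Form ℂ L 7) (g : LinearMap.BilinForm ℂ L) (χ : Form ℂ L 4),
    IsComplexG2Structure φ vol ∧ MetricIdentity φ g vol ∧ IsHodgeDual g vol φ χ ∧ IsClosedForm χ

end Admits

/-! ### Complex Jordan normal form -/

/-- The Jordan block of size `n` with `μ` on the diagonal and `1` on the superdiagonal. -/
def jordanBlock (μ : ℂ) (n : ℕ) : Matrix (Fin n) (Fin n) ℂ :=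
  Matrix.of fun i j => if i = j then μ else if (i : ℕ) + 1 = j then 1 else 0

/-- The Jordan blocks in the complex Jordan normal form of the endomorphism `f` of the real
vector space `U` have the sizes `s` (counted with multiplicity): in some basis of `ℂ ⊗ U` the
complexification of `f` is block diagonal, with non-empty Jordan blocks of these sizes. -/
def HasComplexJordanBlockSizes {U : Type*} [AddCommGroup U] [Module ℝ U] (f : Module.End ℝ U)
    (s : Multiset ℕ) : Prop :=
  ∃ (m : ℕ) (μ : Fin m → ℂ) (n : Fin m → ℕ) (b : Module.Basis (Σ i, Fin (n i)) ℂ (ℂ ⊗[ℝ] U)),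
    (∀ i, 0 < n i) ∧ Finset.univ.val.map n = s ∧
      LinearMap.toMatrix b b (f.baseChange ℂ) =
        Matrix.blockDiagonal' fun i => jordanBlock (μ i) (n i)

/-- The restriction `ad(x)|_u` of `ad x` to an ideal `u`. -/
def adOn {L : Type*} [LieRing L] [LieAlgebra ℝ L] (u : LieIdeal ℝ L) (x : L) :
    Module.End ℝ u :=
  (LieAlgebra.ad ℝ L x : L →ₗ[ℝ] L).restrict (p := u.toSubmodule) (q := u.toSubmodule)
    fun _ hy => u.lie_mem hy

end

end CocalibratedG2

/-! Write `f` for `ad(z)` on the abelian ideal `u`, with `z` outside `u`; it is nilpotent, hence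
traceless. Since `u` is abelian, a four-form `χ` is closed exactly when its restriction to `u` is
killed by `f` acting as a derivation (`isClosedForm_iff_formDeriv_eq_zero`). Up to a volume form, a
four-form on the six-space `u` is a bivector `B`, and because `f` is traceless the condition becomes
`M B + B Mᵀ = 0` with `M` the matrix of `f` (`formDeriv_eq_zero_iff`). For `χ = ⋆φ` the bivector is,
up to a scalar, `φ(y₀, ·, ·)`, where `y₀` is a `g`-normal vector of `u`
(`isClosedForm_iff_toMatrix`). So everything depends on which bivectors arise this way and which
nilpotent `f` annihilate one of them.

For `ε = 1` over the reals the metric is definite and `φ(y₀, ·, ·)` has kernel exactly the line of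
`y₀`, so `B` is invertible (`det_ne_zero_of_standardForm`). Then `M² B` is skew, `f²` has even rank,
and the sum of `n - 2` (truncated at zero) over the Jordan sizes `n` is even
(`even_sum_of_hasComplexJordanBlockSizes`). This fails for `(5,1)`, `(3,2,1)` and `(3,1,1,1)`, the
partitions of six in which some odd part has odd multiplicity. For every other partition an
invariant bivector of rank six is written down (`exists_basis_toMatrix_pairing_three`) and is
realised by a `G₂`-structure (`exists_closed_hodgeDual_one`).

For `ε = -1` the normal vector may be null, and then `B` has rank four. Every nilpotent `f` leaves a
rank-four bivector invariant (`exists_basis_toMatrix_pairing_two`), so there is no obstruction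
(`exists_closed_hodgeDual_neg_one`). Over the complex numbers, rescaling four basis vectors by `±i`
turns `φ₋₁` into `φ₁` with the same volume form (`exists_standardForm_one_eq`), so the same
construction applies. -/

namespace CocalibratedG2

/-! ### Wedge products and coordinate expansions of forms. -/

section FormBasics

variable {K V : Type*} [Field K] [AddCommGroup V] [Module K V]

theorem decomposable_apply {k : ℕ} (α : Fin k → Module.Dual K V) (x : Fin k → V) :
    decomposable α x = (Matrix.of fun b a => α a (x b)).det := rfl

theorem wedge_add_left {k l : ℕ} (α α' : Form K V k) (β : Form K V l) :
    wedge (α + α') β = wedge α β + wedge α' β := by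
  ext x
  simp only [wedge, ← AlternatingMap.domCoprod'_apply, TensorProduct.add_tmul, map_add]
  simp

theorem wedge_add_right {k l : ℕ} (α : Form K V k) (β β' : Form K V l) :
    wedge α (β + β') = wedge α β + wedge α β' := by
  ext x
  simp only [wedge, ← AlternatingMap.domCoprod'_apply, TensorProduct.tmul_add, map_add]
  simp

theorem wedge_smul_left {k l : ℕ} (c : K) (α : Form K V k) (β : Form K V l) :
    wedge (c • α) β = c • wedge α β := by
  ext x
  simp only [wedge, ← AlternatingMap.domCoprod'_apply, ← TensorProduct.smul_tmul', map_smul]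
  simp

theorem wedge_smul_right {k l : ℕ} (c : K) (α : Form K V k) (β : Form K V l) :
    wedge α (c • β) = c • wedge α β := by
  ext x
  simp only [wedge, ← AlternatingMap.domCoprod'_apply, TensorProduct.tmul_smul, map_smul]
  simp

/-- The wedge product as a bilinear map. -/
noncomputable def wedgeLinear (K V : Type*) [Field K] [AddCommGroup V] [Module K V] (k l : ℕ) :
    Form K V k →ₗ[K] Form K V l →ₗ[K] Form K V (k + l) :=
  LinearMap.mk₂ K wedge wedge_add_left wedge_smul_left wedge_add_right wedge_smul_right

theorem wedgeLinear_apply {k l : ℕ} (α : Form K V k) (β : Form K V l) :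
    wedgeLinear K V k l α β = wedge α β := rfl

theorem decomposable_eq_alternatization {k : ℕ} (α : Fin k → Module.Dual K V) :
    decomposable α =
      ((MultilinearMap.mkPiAlgebra K (Fin k) K).compLinearMap α).alternatization := by
  ext x
  rw [decomposable_apply, ← Matrix.det_transpose, Matrix.det_apply,
    MultilinearMap.alternatization_apply, ← Equiv.sum_comp (Equiv.inv _)]
  refine Finset.sum_congr rfl fun σ _ => ?_
  simp only [Equiv.inv_apply, Equiv.Perm.sign_inv, MultilinearMap.domDomCongr_apply,
    MultilinearMap.compLinearMap_apply, MultilinearMap.mkPiAlgebra_apply]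
  congr 1
  rw [← Equiv.prod_comp σ]
  simp

/-- Both factors are alternatizations of products of linear forms, and the shuffle product of
alternatizations is the alternatization of the product. What remains is to carry permutations of
`Fin k ⊕ Fin l` over to `Fin (k + l)`. -/
theorem wedge_decomposable {k l : ℕ} (α : Fin k → Module.Dual K V) (β : Fin l → Module.Dual K V) :
    wedge (decomposable α) (decomposable β) = decomposable (Fin.append α β) := by
  rw [wedge, decomposable_eq_alternatization, decomposable_eq_alternatization,
    decomposable_eq_alternatization, ← MultilinearMap.domCoprod_alternization]
  ext x
  simp only [AlternatingMap.domDomCongr_apply, LinearMap.compAlternatingMap_apply,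
    MultilinearMap.alternatization_apply, map_sum]
  rw [← Equiv.sum_comp (Equiv.permCongr finSumFinEquiv)]
  refine Finset.sum_congr rfl fun σ _ => ?_
  rw [Equiv.Perm.sign_permCongr]
  simp only [Units.smul_def, map_zsmul]
  congr 1
  simp [MultilinearMap.domDomCongr_apply, MultilinearMap.domCoprod_apply, Fin.prod_univ_add,
    Equiv.permCongr_apply]

theorem coordForm_apply {k : ℕ} (e : Module.Basis (Fin 7) K V) (I : Fin k → Fin 7)
    (x : Fin k → V) : coordForm e I x = (Matrix.of fun b a => e.coord (I a) (x b)).det := rfl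

theorem wedge_coordForm {k l : ℕ} (e : Module.Basis (Fin 7) K V) (I : Fin k → Fin 7)
    (J : Fin l → Fin 7) :
    wedge (coordForm e I) (coordForm e J) = coordForm e (Fin.append I J) := by
  rw [coordForm, coordForm, wedge_decomposable, coordForm]
  congr 1
  ext a : 1
  refine Fin.addCases (fun i => ?_) (fun i => ?_) a <;> simp

/-- Expansion of an alternating form along vectors given by their coordinates. -/
theorem sum_apply_mul_det {k : ℕ} {ι : Type*} [Fintype ι] (ξ : Form K V k) (e : ι → V)
    (c : Fin k → ι → K) :
    ∑ I : Fin k → ι, ξ (fun a => e (I a)) * (Matrix.of fun b a => c b (I a)).det =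
      (k.factorial : K) * ξ fun b => ∑ i, c b i • e i := by
  classical
  -- Every term of the Leibniz expansion of the determinant contributes the same value once `I` is
  -- summed over, because the sign from reordering the arguments cancels the sign in the
  -- determinant. Hence the factor `k!`.
  have h1 : ∀ σ : Equiv.Perm (Fin k), ∑ I : Fin k → ι,
      ξ (fun a => e (I a)) * (Equiv.Perm.sign σ • ∏ a, c (σ a) (I a)) =
        ξ fun b => ∑ i, c b i • e i := by
    intro σ
    have h2 := ξ.toMultilinearMap.map_sum (fun (b : Fin k) (i : ι) => c (σ b) i • e i)
    have h3 := ξ.map_perm (fun b => ∑ i, c b i • e i) σ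
    change ξ (fun b => ∑ i, c (σ b) i • e i) = _ at h3
    change ξ (fun b => ∑ i, c (σ b) i • e i) = ∑ I : Fin k → ι, ξ (fun b => c (σ b) (I b) • e (I b))
      at h2
    have h4 : ∀ I : Fin k → ι, ξ (fun b => c (σ b) (I b) • e (I b)) =
        (∏ a, c (σ a) (I a)) * ξ (fun a => e (I a)) := fun I =>
      ξ.toMultilinearMap.map_smul_univ _ _
    simp only [h4] at h2
    have h5 : ξ (fun b => ∑ i, c b i • e i) =
        Equiv.Perm.sign σ • ξ (fun b => ∑ i, c (σ b) i • e i) := by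
      rw [h3, smul_smul, Int.units_mul_self, one_smul]
    rw [h5, h2, Finset.smul_sum]
    refine Finset.sum_congr rfl fun I _ => ?_
    rw [mul_smul_comm, mul_comm]
  simp only [Matrix.det_apply, Finset.mul_sum, Matrix.of_apply]
  rw [Finset.sum_comm]
  simp only [h1]
  simp [Fintype.card_perm]

/-- The evaluation of a form on fixed vectors. -/
def evalAt {k : ℕ} (x : Fin k → V) : Form K V k →ₗ[K] K where
  toFun ξ := ξ x
  map_add' _ _ := rfl
  map_smul' _ _ := rfl

theorem evalAt_apply {k : ℕ} (x : Fin k → V) (ξ : Form K V k) : evalAt x ξ = ξ x := rfl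

/-- The sum runs over all index tuples and not only increasing ones, so each basis form is counted
`k!` times. This avoids ordered indices, at the cost of characteristic zero wherever one has to
divide. -/
theorem sum_smul_coordForm {k : ℕ} (e : Module.Basis (Fin 7) K V) (ξ : Form K V k) :
    ∑ I : Fin k → Fin 7, ξ (fun a => e (I a)) • coordForm e I = (k.factorial : K) • ξ := by
  ext x
  have h := sum_apply_mul_det ξ e (fun b i => e.coord i (x b))
  simp only [Module.Basis.coord_apply, e.sum_repr] at h
  rw [← evalAt_apply, map_sum]
  simpa [evalAt_apply, coordForm_apply] using h

theorem eq_of_forall_coordForm [CharZero K] {k : ℕ} {N : Type*} [AddCommGroup N] [Module K N]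
    (e : Module.Basis (Fin 7) K V) {f g : Form K V k →ₗ[K] N}
    (h : ∀ I : Fin k → Fin 7, f (coordForm e I) = g (coordForm e I)) : f = g := by
  ext ξ
  have h1 : (k.factorial : K) ≠ 0 := by exact_mod_cast k.factorial_ne_zero
  have h2 := sum_smul_coordForm e ξ
  rw [← smul_right_injective N h1 |>.eq_iff]
  simp only [← map_smul, ← h2, map_sum]
  simp only [map_smul, h]

theorem coordForm_apply_basis {k : ℕ} (e : Module.Basis (Fin 7) K V) (I J : Fin k → Fin 7) :
    coordForm e I (fun a => e (J a)) =
      (Matrix.of fun b a => if J b = I a then (1 : K) else 0).det := by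
  rw [coordForm_apply]
  congr 1
  ext b a
  simp [Finsupp.single_apply]

/-- The last `l` columns select the last `l` rows, so the matrix is block triangular with an
identity block in the lower right corner. -/
theorem det_append_of_injective {k l : ℕ} {ι : Type*} [DecidableEq ι] (s : Fin (k + l) → ι)
    (hs : Function.Injective s) (I : Fin k → ι) :
    (Matrix.of fun b a => if s b = Fin.append I (fun a => s (Fin.natAdd k a)) a then (1 : K)
      else 0).det =
    (Matrix.of fun b a => if s (Fin.castAdd l b) = I a then (1 : K) else 0).det := by
  set A := (Matrix.of fun b a => if s b = Fin.append I (fun a => s (Fin.natAdd k a)) a then (1 : K)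
      else 0) with hA
  rw [← Matrix.det_reindex_self finSumFinEquiv.symm A,
    ← Matrix.fromBlocks_toBlocks (Matrix.reindex _ _ _)]
  have h0 : (Matrix.reindex finSumFinEquiv.symm finSumFinEquiv.symm A).toBlocks₁₂ = 0 := by
    ext b a
    have : Fin.castAdd l b ≠ Fin.natAdd k a := by
      intro h; have := congrArg Fin.val h; simp at this; omega
    simp [Matrix.toBlocks₁₂, hA, hs.eq_iff, this]
  have h1 : (Matrix.reindex finSumFinEquiv.symm finSumFinEquiv.symm A).toBlocks₂₂ = 1 := by
    ext b a
    simp [Matrix.toBlocks₂₂, hA, hs.eq_iff, Matrix.one_apply]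
  rw [h0, h1, Matrix.det_fromBlocks_zero₁₂, Matrix.det_one, mul_one]
  congr 1
  ext b a
  simp [Matrix.toBlocks₁₁, hA]

/-- Wedging with a coordinate four-form reads off the coefficient of `φ` on the complementary
triple. Both sides are linear in `φ`, so coordinate forms suffice. -/
theorem wedge_coordForm_apply_basis [CharZero K] (e : Module.Basis (Fin 7) K V)
    (φ : Form K V 3) (σ : Equiv.Perm (Fin 7)) :
    wedge φ (coordForm e fun a : Fin 4 => σ (Fin.natAdd 3 a)) e =
      ((Equiv.Perm.sign σ : ℤ) : K) * φ fun a => e (σ (Fin.castAdd 4 a)) := by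
  have key : (evalAt (k := 3 + 4) ⇑e) ∘ₗ
      (wedgeLinear K V 3 4).flip (coordForm e fun a : Fin 4 => σ (Fin.natAdd 3 a)) =
      ((Equiv.Perm.sign σ : ℤ) : K) • evalAt fun a => e (σ (Fin.castAdd 4 a)) := by
    refine eq_of_forall_coordForm e fun I => ?_
    simp only [LinearMap.comp_apply, LinearMap.flip_apply, wedgeLinear_apply, evalAt_apply,
      wedge_coordForm, LinearMap.smul_apply]
    have h (T : Form K V (3 + 4)) : T e = Equiv.Perm.sign σ • T (fun b => e (σ b)) := by
      have := T.map_perm ⇑e σ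
      change T (fun b => e (σ b)) = _ at this
      rw [this, smul_smul, Int.units_mul_self, one_smul]
    have h2 := det_append_of_injective (K := K) (k := 3) (l := 4) σ σ.injective I
    rw [h, coordForm_apply_basis e (Fin.append I fun a : Fin 4 => σ (Fin.natAdd 3 a)) σ,
      coordForm_apply_basis, Units.smul_def, zsmul_eq_mul, smul_eq_mul]
    exact congrArg _ h2
  have := LinearMap.congr_fun key φ
  simp only [LinearMap.comp_apply, LinearMap.flip_apply, wedgeLinear_apply, evalAt_apply,
    LinearMap.smul_apply, smul_eq_mul] at this
  exact this

end FormBasics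

/-! ### The metric and the volume form of the standard three-forms. -/

section Metric

variable {K V : Type*} [Field K] [AddCommGroup V] [Module K V]

/-- The sign of `b - a`. -/
def cmpSign (a b : ℕ) : ℤ := if a < b then 1 else if b < a then -1 else 0

/-- The sign of a list of numbers as a sequence of values of a permutation, and zero if there are
repetitions. -/
def listSign : List ℕ → ℤ
  | [] => 1
  | a :: l => (l.map (cmpSign a)).prod * listSign l

/-- The sign of a map `Fin n → Fin m` as the product over all pairs of arguments. -/
def pairSign {n m : ℕ} (I : Fin n → Fin m) : ℤ :=
  ∏ i, ∏ j ∈ Finset.Ioi i, cmpSign (I i) (I j)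

theorem pairSign_perm {n : ℕ} (σ : Equiv.Perm (Fin n)) :
    pairSign σ = (Equiv.Perm.sign σ : ℤ) := by
  rw [σ.sign_eq_prod_prod_Ioi, pairSign, Units.coe_prod]
  refine Finset.prod_congr rfl fun i _ => ?_
  rw [Units.coe_prod]
  refine Finset.prod_congr rfl fun j hj => ?_
  have hij : i ≠ j := (Finset.mem_Ioi.mp hj).ne
  rcases lt_trichotomy (σ i) (σ j) with h | h | h
  · simp [cmpSign, h]
  · exact absurd (σ.injective h) hij
  · simp [cmpSign, h, h.not_gt]

theorem pairSign_eq_zero {n m : ℕ} {I : Fin n → Fin m} (hI : ¬ Function.Injective I) :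
    pairSign I = 0 := by
  simp only [Function.Injective, not_forall] at hI
  obtain ⟨i, j, h, hij⟩ := hI
  wlog hlt : i < j generalizing i j
  · exact this j i h.symm (Ne.symm hij) (lt_of_le_of_ne (not_lt.mp hlt) (Ne.symm hij))
  refine Finset.prod_eq_zero (Finset.mem_univ i) ?_
  exact Finset.prod_eq_zero (Finset.mem_Ioi.mpr hlt) (by simp [cmpSign, h])

/-- Replaces a determinant by an integer product over pairs, which the kernel can evaluate. -/
theorem det_indicator_eq_pairSign {n : ℕ} (I : Fin n → Fin n) :
    (Matrix.of fun b a => if b = I a then (1 : K) else 0).det = (pairSign I : K) := by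
  by_cases hI : Function.Injective I
  · obtain ⟨σ, rfl⟩ : ∃ σ : Equiv.Perm (Fin n), I = σ :=
      ⟨Equiv.ofBijective I (Finite.injective_iff_bijective.mp hI), rfl⟩
    rw [pairSign_perm, ← Matrix.det_permutation, ← Matrix.det_transpose]
    congr 1
    ext a b
    simp [Equiv.toPEquiv_apply, PEquiv.toMatrix_apply, eq_comm]
  · rw [pairSign_eq_zero hI, Int.cast_zero]
    simp only [Function.Injective, not_forall] at hI
    obtain ⟨i, j, h, hij⟩ := hI
    exact Matrix.det_zero_of_column_eq hij fun b => by simp [h]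

theorem pairSign_seven (a b c d f g h : Fin 7) :
    pairSign ![a, b, c, d, f, g, h] = listSign [a, b, c, d, f, g, h] := by
  simp [pairSign, listSign, Fin.prod_univ_succ, Fin.prod_Ioi_succ]

theorem coordForm_seven_apply (e : Module.Basis (Fin 7) K V) (I : Fin 7 → Fin 7) :
    coordForm e I e = (pairSign I : K) := by
  rw [coordForm_apply, ← det_indicator_eq_pairSign]
  congr 1
  ext b a
  simp [Finsupp.single_apply]

theorem basisVolume_apply_self (e : Module.Basis (Fin 7) K V) : basisVolume e e = 1 := by
  have h : pairSign (n := 7) (m := 7) ![0, 1, 2, 3, 4, 5, 6] = 1 := by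
    rw [pairSign_seven]; decide
  rw [basisVolume, coordForm_seven_apply, h, Int.cast_one]

theorem eq_smul_basisVolume (e : Module.Basis (Fin 7) K V) (T : Form K V 7) :
    T = T e • basisVolume e := by
  refine Module.Basis.ext_alternating e fun I hI => ?_
  let σ : Equiv.Perm (Fin 7) := Equiv.ofBijective I (Finite.injective_iff_bijective.mp hI)
  have h (S : Form K V 7) : S (fun i => e (I i)) = Equiv.Perm.sign σ • S e := S.map_perm e σ
  simp only [AlternatingMap.smul_apply, h, basisVolume_apply_self]
  rw [Units.smul_def, Units.smul_def, zsmul_eq_mul, zsmul_eq_mul, smul_eq_mul, mul_one, mul_comm]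

/-- The bilinear form with `g(eᵢ, eᵢ) = ε` for the first four and `g(eᵢ, eᵢ) = 1` for the last
three vectors of a basis. -/
noncomputable def diagForm (ε : K) (e : Module.Basis (Fin 7) K V) : LinearMap.BilinForm K V :=
  ∑ i : Fin 7, (if (i : ℕ) < 4 then ε else 1) • (e.coord i).smulRight (e.coord i)

theorem diagForm_apply (ε : K) (e : Module.Basis (Fin 7) K V) (v w : V) :
    diagForm ε e v w =
      ∑ i : Fin 7, (if (i : ℕ) < 4 then ε else 1) * (e.coord i v * e.coord i w) := by
  simp only [diagForm, LinearMap.sum_apply, LinearMap.smul_apply, LinearMap.smulRight_apply,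
    smul_eq_mul]

theorem diagForm_basis (ε : K) (e : Module.Basis (Fin 7) K V) (i j : Fin 7) :
    diagForm ε e (e i) (e j) = if i = j then (if (i : ℕ) < 4 then ε else 1) else 0 := by
  rw [diagForm_apply]
  by_cases h : i = j
  · subst h; simp [Finsupp.single_apply]
  · simp [Finsupp.single_apply, h]

theorem contract_coordForm (e : Module.Basis (Fin 7) K V) (i a b c : Fin 7) :
    contract (e i) (coordForm e ![a, b, c]) =
      (if i = a then (1 : K) else 0) • coordForm e ![b, c]
        - (if i = b then (1 : K) else 0) • coordForm e ![a, c]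
        + (if i = c then (1 : K) else 0) • coordForm e ![a, b] := by
  ext x
  simp only [contract, AlternatingMap.curryLeft_apply_apply, AlternatingMap.add_apply,
    AlternatingMap.sub_apply, AlternatingMap.smul_apply]
  rw [coordForm_apply, coordForm_apply, coordForm_apply, coordForm_apply]
  simp [Matrix.det_fin_three, Matrix.det_fin_two, Finsupp.single_apply]
  split_ifs <;> ring

/-- The coefficients and indices of the terms of `standardForm`. -/
def standardTerms (ε : ℤ) : List (ℤ × Fin 7 × Fin 7 × Fin 7) :=
  [(ε, 0, 1, 6), (ε, 2, 3, 6), (1, 4, 5, 6), (1, 0, 2, 4), (-1, 0, 3, 5), (-1, 1, 2, 5),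
    (-1, 1, 3, 4)]

/-- The coefficients and indices of the terms of the contraction of a three-form. -/
def contractTerms (i : Fin 7) (l : List (ℤ × Fin 7 × Fin 7 × Fin 7)) :
    List (ℤ × Fin 7 × Fin 7) :=
  l.flatMap fun t =>
    (if i = t.2.1 then [(t.1, t.2.2.1, t.2.2.2)] else []) ++
    (if i = t.2.2.1 then [(-t.1, t.2.1, t.2.2.2)] else []) ++
    (if i = t.2.2.2 then [(t.1, t.2.1, t.2.2.1)] else [])

/-- The three-form with given terms. -/
noncomputable def sumThree (e : Module.Basis (Fin 7) K V) (l : List (ℤ × Fin 7 × Fin 7 × Fin 7)) :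
    Form K V 3 :=
  (l.map fun t => (t.1 : K) • coordForm e ![t.2.1, t.2.2.1, t.2.2.2]).sum

/-- The two-form with given terms. -/
noncomputable def sumTwo (e : Module.Basis (Fin 7) K V) (l : List (ℤ × Fin 7 × Fin 7)) :
    Form K V 2 :=
  (l.map fun t => (t.1 : K) • coordForm e ![t.2.1, t.2.2]).sum

theorem standardForm_eq_sumThree (ε : ℤ) (e : Module.Basis (Fin 7) K V) :
    standardForm (ε : K) e = sumThree e (standardTerms ε) := by
  simp [standardForm, sumThree, standardTerms]
  module

theorem contract_sumThree (e : Module.Basis (Fin 7) K V) (i : Fin 7)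
    (l : List (ℤ × Fin 7 × Fin 7 × Fin 7)) :
    contract (e i) (sumThree e l) = sumTwo e (contractTerms i l) := by
  induction l with
  | nil => simp [sumThree, sumTwo, contractTerms, contract]
  | cons t l ih =>
    obtain ⟨c, a, b, d⟩ := t
    have h1 : sumThree e ((c, a, b, d) :: l) =
      (c : K) • coordForm e ![a, b, d] + sumThree e l := by simp [sumThree]
    have h2 : contract (e i) ((c : K) • coordForm e ![a, b, d] + sumThree e l) =
      (c : K) • contract (e i) (coordForm e ![a, b, d]) + contract (e i) (sumThree e l) := by
      rw [contract, AlternatingMap.curryLeft_add, AlternatingMap.curryLeft_smul]; rfl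
    rw [h1, h2, ih, contract_coordForm]
    simp only [sumTwo, contractTerms, List.flatMap_cons, List.map_append, List.sum_append]
    congr 1
    split_ifs <;> simp <;> module

/-- The coefficient of the volume form in the wedge product of two two-forms and a three-form. -/
def wedgeTerms (l m : List (ℤ × Fin 7 × Fin 7)) (n : List (ℤ × Fin 7 × Fin 7 × Fin 7)) : ℤ :=
  (l.map fun s => s.1 * (m.map fun t => t.1 * (n.map fun r => r.1 *
    listSign [s.2.1, s.2.2, t.2.1, t.2.2, r.2.1, r.2.2.1, r.2.2.2]).sum).sum).sum

theorem wedge_sumTwo_sumTwo_sumThree (e : Module.Basis (Fin 7) K V)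
    (l m : List (ℤ × Fin 7 × Fin 7)) (n : List (ℤ × Fin 7 × Fin 7 × Fin 7)) :
    wedge (wedge (sumTwo e l) (sumTwo e m)) (sumThree e n) e = (wedgeTerms l m n : K) := by
  have h (a b c d f g h : Fin 7) : wedge (wedge (coordForm e ![a, b]) (coordForm e ![c, d]))
      (coordForm e ![f, g, h]) e = (listSign [a, b, c, d, f, g, h] : K) := by
    rw [← pairSign_seven, ← coordForm_seven_apply e, wedge_coordForm, wedge_coordForm]
    have : (Fin.append (Fin.append ![a, b] ![c, d]) ![f, g, h] : Fin 7 → Fin 7) =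
        ![a, b, c, d, f, g, h] := by
      funext i; fin_cases i <;> rfl
    generalize ⇑e = x
    generalize hI : (Fin.append (Fin.append ![a, b] ![c, d]) ![f, g, h] : Fin 7 → Fin 7) = I at this
    rw [← this, ← hI]
  have h3 (a b c d : Fin 7) : wedge (wedge (coordForm e ![a, b]) (coordForm e ![c, d]))
      (sumThree e n) e = ((n.map fun r => r.1 *
        listSign [a, b, c, d, r.2.1, r.2.2.1, r.2.2.2]).sum : ℤ) := by
    induction n with
    | nil => simp [sumThree, ← wedgeLinear_apply]
    | cons t n ih =>
      have h1 : sumThree e (t :: n) =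
        (t.1 : K) • coordForm e ![t.2.1, t.2.2.1, t.2.2.2] + sumThree e n := by simp [sumThree]
      rw [h1, wedge_add_right, wedge_smul_right, AlternatingMap.add_apply, ih,
        AlternatingMap.smul_apply, h, List.map_cons, List.sum_cons]
      push_cast
      rfl
  have h2 (a b : Fin 7) : wedge (wedge (coordForm e ![a, b]) (sumTwo e m)) (sumThree e n) e =
      ((m.map fun t => t.1 * (n.map fun r => r.1 *
        listSign [a, b, t.2.1, t.2.2, r.2.1, r.2.2.1, r.2.2.2]).sum).sum : ℤ) := by
    induction m with
    | nil => simp [sumTwo, ← wedgeLinear_apply]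
    | cons t m ih =>
      have h1 : sumTwo e (t :: m) = (t.1 : K) • coordForm e ![t.2.1, t.2.2] + sumTwo e m := by
        simp [sumTwo]
      rw [h1, wedge_add_right, wedge_smul_right, wedge_add_left, wedge_smul_left,
        AlternatingMap.add_apply, ih, AlternatingMap.smul_apply, h3, List.map_cons, List.sum_cons]
      push_cast
      rfl
  induction l with
  | nil => simp [sumTwo, wedgeTerms, ← wedgeLinear_apply]
  | cons t l ih =>
    have h1 : sumTwo e (t :: l) = (t.1 : K) • coordForm e ![t.2.1, t.2.2] + sumTwo e l := by
      simp [sumTwo]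
    rw [h1, wedge_add_left, wedge_smul_left, wedge_add_left, wedge_smul_left,
      AlternatingMap.add_apply, ih, AlternatingMap.smul_apply, h2, wedgeTerms, wedgeTerms,
      List.map_cons, List.sum_cons]
    push_cast
    rfl

/-- The metric identity on basis vectors, reduced to a finite computation with integer lists. -/
theorem wedgeTerms_standard (ε : ℤ) (hε : ε = 1 ∨ ε = -1) (i j : Fin 7) :
    wedgeTerms (contractTerms i (standardTerms ε)) (contractTerms j (standardTerms ε))
      (standardTerms ε) = 6 * if i = j then (if (i : ℕ) < 4 then ε else 1) else 0 := by
  rcases hε with rfl | rfl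
  · revert i j; decide +kernel
  · revert i j; decide +kernel

theorem wedge_contract_contract_standardForm [CharZero K] (ε : ℤ) (hε : ε = 1 ∨ ε = -1)
    (e : Module.Basis (Fin 7) K V) (v w : V) :
    wedge (wedge (contract v (standardForm (ε : K) e)) (contract w (standardForm (ε : K) e)))
      (standardForm (ε : K) e) e = 6 * diagForm (ε : K) e v w := by
  let C : V →ₗ[K] Form K V 2 := AlternatingMap.curryLeftLinearMap (standardForm (ε : K) e)
  let F : LinearMap.BilinForm K V :=
    ((wedgeLinear K V 2 2).compr₂ (evalAt (k := 2 + 2 + 3) e ∘ₗ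
      (wedgeLinear K V (2 + 2) 3).flip (standardForm (ε : K) e))).compl₁₂ C C
  have hF (v w : V) : F v w = wedge (wedge (contract v (standardForm (ε : K) e))
      (contract w (standardForm (ε : K) e))) (standardForm (ε : K) e) e := by
    simp only [F, C, LinearMap.compl₁₂_apply, LinearMap.compr₂_apply, LinearMap.flip_apply,
      LinearMap.comp_apply, wedgeLinear_apply, AlternatingMap.curryLeftLinearMap_apply, contract,
      evalAt_apply]
  have h : F = (6 : K) • diagForm (ε : K) e := by
    refine e.ext fun i => e.ext fun j => ?_
    rw [hF, standardForm_eq_sumThree, contract_sumThree, contract_sumThree,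
      wedge_sumTwo_sumTwo_sumThree, wedgeTerms_standard ε hε, LinearMap.smul_apply,
      LinearMap.smul_apply, diagForm_basis, smul_eq_mul]
    push_cast
    rfl
  rw [← hF, h, LinearMap.smul_apply, LinearMap.smul_apply, smul_eq_mul]

theorem MetricIdentity.smul_eq_smul {φ : Form K V 3} {g g' : LinearMap.BilinForm K V}
    {vol vol' : Form K V 7} (h : MetricIdentity φ g vol) (h' : MetricIdentity φ g' vol') (v w : V) :
    g v w • vol = g' v w • vol' :=
  (h v w).trans (h' v w).symm

theorem metricIdentity_standardForm [CharZero K] (ε : ℤ) (hε : ε = 1 ∨ ε = -1)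
    (e : Module.Basis (Fin 7) K V) :
    MetricIdentity (standardForm (ε : K) e) (diagForm (ε : K) e) (basisVolume e) := by
  intro v w
  have h1 := wedge_contract_contract_standardForm ε hε e v w
  generalize hT : (wedge (wedge (contract v (standardForm (ε : K) e))
    (contract w (standardForm (ε : K) e))) (standardForm (ε : K) e) : Form K V 7) = T at h1 ⊢
  rw [eq_smul_basisVolume e T, h1, smul_smul]
  congr 1
  field_simp

theorem basisVolume_apply (e : Module.Basis (Fin 7) K V) (x : Fin 7 → V) :
    basisVolume e x = (Matrix.of fun b a => e.coord a (x b)).det := by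
  rw [basisVolume, coordForm_apply]
  congr 1
  ext b a
  fin_cases a <;> rfl

/-- The metric identity only fixes the product of metric and volume, so the two solutions satisfy `g
= c g'` and `vol' = c vol`. With `P` the change of basis, the volumes give `c det P = 1` and the
Gram matrices give `(det P)² = c⁷`, so `c⁹ = 1`. Trivial ninth roots of unity then force `c = 1`. -/
theorem eq_of_smul_eq_smul (hK : ∀ c : K, c ^ 9 = 1 → c = 1) (ε : K) (hε : ε ≠ 0)
    (e e' : Module.Basis (Fin 7) K V)
    {T T' : Form K V 7} (hT : T e = 1) (hT' : T' e' = 1) (hTT' : T' = T' e • T)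
    (hdet : T e' = (Matrix.of fun b a => e.coord a (e' b)).det)
    (h : ∀ v w, diagForm ε e v w • T = diagForm ε e' v w • T') :
    T = T' ∧ diagForm ε e = diagForm ε e' := by
  have h3 (v w : V) : diagForm ε e v w = T' e * diagForm ε e' v w := by
    have := congrArg (evalAt e) (h v w)
    rwa [map_smul, map_smul, evalAt_apply, evalAt_apply, hT, smul_eq_mul, smul_eq_mul, mul_one,
      mul_comm (diagForm ε e' v w)] at this
  set c := T' e with hc
  set D : Matrix (Fin 7) (Fin 7) K :=
    Matrix.diagonal fun i => if (i : ℕ) < 4 then ε else 1 with hD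
  set P : Matrix (Fin 7) (Fin 7) K := Matrix.of fun b a => e.coord a (e' b) with hP
  have h4 : P * D * P.transpose = c • D := by
    ext i j
    have h5 := h3 (e' i) (e' j)
    rw [diagForm_basis, diagForm_apply] at h5
    rw [Matrix.mul_assoc, Matrix.mul_apply]
    simp only [hD, Matrix.diagonal_mul, Matrix.smul_apply, Matrix.diagonal_apply, smul_eq_mul,
      Matrix.transpose_apply, hP, Matrix.of_apply]
    rw [← h5]
    exact Finset.sum_congr rfl fun k _ => by ring
  have h6 : c * P.det = 1 := by
    have h7 := congrArg (evalAt e') hTT'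
    rwa [map_smul, evalAt_apply, evalAt_apply, hT', hdet, smul_eq_mul, eq_comm] at h7
  have hDdet : D.det ≠ 0 := by
    rw [hD, Matrix.det_diagonal, Finset.prod_ne_zero_iff]
    intro i _
    split_ifs
    exacts [hε, one_ne_zero]
  have h8 : P.det * P.det = c ^ 7 := by
    have := congrArg Matrix.det h4
    rw [Matrix.det_mul, Matrix.det_mul, Matrix.det_transpose, Matrix.det_smul,
      Fintype.card_fin] at this
    apply mul_right_cancel₀ hDdet
    linear_combination this
  have h9 : c = 1 := by
    have h10 : c ^ 9 = 1 := by
      linear_combination (-c ^ 2) * h8 + (c * P.det + 1) * h6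
    exact hK c h10
  refine ⟨by rw [hTT', h9, one_smul], ?_⟩
  ext v w
  rw [h3, h9, one_mul]

theorem basisVolume_eq_and_diagForm_eq (hK : ∀ c : K, c ^ 9 = 1 → c = 1) (ε : K) (hε : ε ≠ 0)
    (e e' : Module.Basis (Fin 7) K V)
    (h : ∀ v w, diagForm ε e v w • basisVolume e = diagForm ε e' v w • basisVolume e') :
    basisVolume e = basisVolume e' ∧ diagForm ε e = diagForm ε e' := by
  have h3 := basisVolume_apply_self e
  have h4 := basisVolume_apply_self e'
  have h5 := eq_smul_basisVolume e (basisVolume e')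
  have h6 := basisVolume_apply e e'
  generalize basisVolume e = T at h3 h5 h6 h ⊢
  generalize basisVolume e' = T' at h4 h5 h ⊢
  exact eq_of_smul_eq_smul hK ε hε e e' h3 h4 h5 h6 h

end Metric

theorem isInducedMetric_standardForm {V : Type*} [AddCommGroup V] [Module ℝ V] (ε : ℤ)
    (hε : ε = 1 ∨ ε = -1) (e : Module.Basis (Fin 7) ℝ V) :
    IsInducedMetric (ε : ℝ) (standardForm (ε : ℝ) e) (diagForm (ε : ℝ) e) (basisVolume e) := by
  have hε' : (ε : ℝ) ≠ 0 := by rcases hε with rfl | rfl <;> norm_num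
  -- An odd power is injective on the reals, so the only real ninth root of unity is `1`.
  have hK (c : ℝ) (hc : c ^ 9 = 1) : c = 1 := by
    have h : Odd 9 := by decide
    exact h.strictMono_pow.injective (by simpa using hc)
  have key : ∀ e', IsAdaptedBasis (ε : ℝ) (standardForm (ε : ℝ) e) e' →
      basisVolume e = basisVolume e' ∧ diagForm (ε : ℝ) e = diagForm (ε : ℝ) e' := by
    intro e' he'
    have h1 := metricIdentity_standardForm ε hε e
    have h2 := metricIdentity_standardForm ε hε e'
    rw [← he'] at h2
    exact basisVolume_eq_and_diagForm_eq hK (ε : ℝ) hε' e e' (h1.smul_eq_smul h2)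
  refine ⟨metricIdentity_standardForm ε hε e, fun e' he' => (key e' he').1, fun e' he' i j => ?_⟩
  rw [(key e' he').2, diagForm_basis]

/-! ### Induced forms and the Hodge dual. -/

section Hodge

variable {K V : Type*} [Field K] [AddCommGroup V] [Module K V]

/-- The bilinear form on `k`-forms for which the forms `coordForm e I` are orthogonal with norms
given by products of the weights `w`. -/
noncomputable def diagFormOnForms (w : Fin 7 → K) (e : Module.Basis (Fin 7) K V) (k : ℕ) :
    LinearMap.BilinForm K (Form K V k) :=
  (1 / (k.factorial : K)) • ∑ I : Fin k → Fin 7,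
    (∏ a, w (I a)) • (evalAt fun a => e (I a)).smulRight (evalAt fun a => e (I a))

theorem diagFormOnForms_apply (w : Fin 7 → K) (e : Module.Basis (Fin 7) K V) {k : ℕ}
    (χ ξ : Form K V k) :
    diagFormOnForms w e k χ ξ = (1 / (k.factorial : K)) * ∑ I : Fin k → Fin 7,
      (∏ a, w (I a)) * ((χ fun a => e (I a)) * (ξ fun a => e (I a))) := by
  simp only [diagFormOnForms, LinearMap.smul_apply, LinearMap.sum_apply, LinearMap.smulRight_apply,
    smul_eq_mul, evalAt_apply]

theorem diagFormOnForms_comm (w : Fin 7 → K) (e : Module.Basis (Fin 7) K V) {k : ℕ}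
    (χ ξ : Form K V k) : diagFormOnForms w e k χ ξ = diagFormOnForms w e k ξ χ := by
  rw [diagFormOnForms_apply, diagFormOnForms_apply]
  congr 1
  exact Finset.sum_congr rfl fun I _ => by ring

/-- Weights with square one are their own inverses, so the dual metric carries the same weights; the
factor `1 / k!` compensates for summing over all index tuples. -/
theorem isInducedOnForms_diagFormOnForms [CharZero K] {w : Fin 7 → K} (hw : ∀ i, w i * w i = 1)
    {e : Module.Basis (Fin 7) K V} {g : LinearMap.BilinForm K V}
    (hg : ∀ y i, g y (e i) = w i * e.coord i y) (k : ℕ) :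
    IsInducedOnForms g (diagFormOnForms w e k) := by
  intro χ y
  have h := sum_apply_mul_det χ e fun b i => w i * g (y b) (e i)
  have h1 (b : Fin k) : ∑ i, (w i * g (y b) (e i)) • e i = y b := by
    simp only [hg, ← mul_assoc, hw, one_mul, Module.Basis.coord_apply, e.sum_repr]
  simp only [h1] at h
  have h2 : (k.factorial : K) ≠ 0 := by exact_mod_cast k.factorial_ne_zero
  rw [diagFormOnForms_apply, one_div, inv_mul_eq_iff_eq_mul₀ h2, ← h]
  refine Finset.sum_congr rfl fun I _ => ?_
  have h3 := Matrix.det_mul_row (fun a => w (I a)) (Matrix.of fun b a => g (y b) (e (I a)))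
  simp only [Matrix.of_apply] at h3
  rw [h3, decomposable_apply, ← Matrix.det_transpose]
  have h4 : (Matrix.of fun b a => g (y a) (e (I b))).transpose =
    Matrix.of fun b a => g (y b) (e (I a)) := rfl
  rw [h4]
  ring

theorem diagFormOnForms_coordForm [CharZero K] {w : Fin 7 → K} (hw : ∀ i, w i * w i = 1)
    (e : Module.Basis (Fin 7) K V) {k : ℕ} (χ : Form K V k) (I : Fin k → Fin 7) :
    diagFormOnForms w e k χ (coordForm e I) = (∏ a, w (I a)) * χ fun a => e (I a) := by
  let g : LinearMap.BilinForm K V := ∑ i, w i • (e.coord i).smulRight (e.coord i)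
  have hg1 (y : V) (i : Fin 7) : g y (e i) = w i * e.coord i y := by
    simp [g, LinearMap.sum_apply, Finsupp.single_apply]
  have hg2 (i : Fin 7) : e.coord i = w i • g (e i) := by
    refine e.ext fun j => ?_
    rw [LinearMap.smul_apply, hg1, smul_eq_mul]
    by_cases h : i = j
    · subst h; simp [hw]
    · simp [h, Ne.symm h]
  have h := isInducedOnForms_diagFormOnForms hw hg1 k χ fun a => w (I a) • e (I a)
  have h3 : (decomposable fun a => g (w (I a) • e (I a))) = coordForm e I := by
    rw [coordForm]
    congr 1
    ext1 a
    rw [map_smul, hg2]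
  rw [h3] at h
  rw [h]
  exact χ.toMultilinearMap.map_smul_univ _ _

/-- The weighted form is non-degenerate, so every functional is represented. Applied to `ξ ↦ φ ∧ ξ`
this produces the Hodge dual. -/
theorem exists_diagFormOnForms_eq [CharZero K] {w : Fin 7 → K} (hw : ∀ i, w i * w i = 1)
    (e : Module.Basis (Fin 7) K V) {k : ℕ} (lam : Form K V k →ₗ[K] K) :
    ∃ χ, ∀ ξ, diagFormOnForms w e k χ ξ = lam ξ := by
  refine ⟨(1 / (k.factorial : K)) •
    ∑ I : Fin k → Fin 7, ((∏ a, w (I a)) * lam (coordForm e I)) • coordForm e I, fun ξ => ?_⟩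
  have hk : (k.factorial : K) ≠ 0 := by exact_mod_cast k.factorial_ne_zero
  rw [diagFormOnForms_comm]
  simp only [map_smul, map_sum, diagFormOnForms_coordForm hw]
  have h := congrArg lam (sum_smul_coordForm e ξ)
  rw [map_sum, map_smul, smul_eq_mul] at h
  rw [smul_eq_mul, one_div, inv_mul_eq_iff_eq_mul₀ hk, ← h]
  refine Finset.sum_congr rfl fun I _ => ?_
  have h5 : (∏ a, w (I a)) * (∏ a, w (I a)) = 1 := by
    rw [← Finset.prod_mul_distrib]; simp [hw]
  rw [map_smul, smul_eq_mul, smul_eq_mul]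
  linear_combination (lam (coordForm e I) * ξ fun a => e (I a)) * h5

theorem isHodgeDual_of_forall_apply {g : LinearMap.BilinForm K V} {e : Module.Basis (Fin 7) K V}
    {φ : Form K V 3} {χ : Form K V 4} {G : LinearMap.BilinForm K (Form K V 4)}
    (hG : IsInducedOnForms g G) (h : ∀ ξ, G χ ξ = wedge φ ξ e) :
    IsHodgeDual g (basisVolume e) φ χ := by
  refine ⟨G, hG, fun ξ => ?_⟩
  rw [h]
  generalize (wedge φ ξ : Form K V (3 + 4)) = T
  exact eq_smul_basisVolume e T

theorem exists_isHodgeDual [CharZero K] {w : Fin 7 → K} (hw : ∀ i, w i * w i = 1)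
    {e : Module.Basis (Fin 7) K V} {g : LinearMap.BilinForm K V}
    (hg : ∀ y i, g y (e i) = w i * e.coord i y) (φ : Form K V 3) :
    ∃ χ, IsHodgeDual g (basisVolume e) φ χ := by
  obtain ⟨χ, hχ⟩ := exists_diagFormOnForms_eq hw e
    (evalAt (k := 3 + 4) e ∘ₗ wedgeLinear K V 3 4 φ)
  refine ⟨χ, isHodgeDual_of_forall_apply (isInducedOnForms_diagFormOnForms hw hg 4) fun ξ => ?_⟩
  rw [hχ, LinearMap.comp_apply, evalAt_apply, wedgeLinear_apply]

theorem diagForm_apply_basis (ε : K) (e : Module.Basis (Fin 7) K V) (y : V) (i : Fin 7) :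
    diagForm ε e y (e i) = (if (i : ℕ) < 4 then ε else 1) * e.coord i y := by
  rw [diagForm_apply, Finset.sum_eq_single i]
  · simp
  · intro j _ hj; simp [hj.symm]
  · simp

theorem exists_isHodgeDual_diagForm [CharZero K] {ε : K} (hε : ε * ε = 1)
    (e : Module.Basis (Fin 7) K V) (φ : Form K V 3) :
    ∃ χ, IsHodgeDual (diagForm ε e) (basisVolume e) φ χ :=
  exists_isHodgeDual (w := fun i => if (i : ℕ) < 4 then ε else 1)
    (fun i => by split_ifs <;> simp [hε]) (diagForm_apply_basis ε e) φ

/-- Testing the defining equation against `g(v_a) ∧ g(v_b) ∧ g(v_c) ∧ g(v_d)`, which is a coordinate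
form of the dual basis `y`, gives the Hodge dual on four vectors of `v` as `φ` on the complementary
three of `y`. No orthogonality within `v` is needed, which is what allows null normal vectors later.
-/
theorem IsHodgeDual.apply_basis [CharZero K] {g : LinearMap.BilinForm K V} {vol : Form K V 7}
    {φ : Form K V 3} {χ : Form K V 4} (h : IsHodgeDual g vol φ χ) {v y : Module.Basis (Fin 7) K V}
    (hvy : ∀ i j, g (v i) (y j) = if i = j then 1 else 0) (σ : Equiv.Perm (Fin 7)) :
    (χ fun a => v (σ (Fin.natAdd 3 a))) * vol y =
      ((Equiv.Perm.sign σ : ℤ) : K) * φ fun a => y (σ (Fin.castAdd 4 a)) := by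
  obtain ⟨G, hG, hwedge⟩ := h
  have h1 (i : Fin 7) : g (v i) = y.coord i := by
    refine y.ext fun j => ?_
    rw [hvy]
    simp [Finsupp.single_apply, eq_comm]
  have h2 := hG χ fun a => v (σ (Fin.natAdd 3 a))
  have h3 := hwedge (decomposable fun a => g (v (σ (Fin.natAdd 3 a))))
  have h4 : (decomposable fun a => g (v (σ (Fin.natAdd 3 a)))) =
      coordForm y fun a : Fin 4 => σ (Fin.natAdd 3 a) := by
    simp only [h1]; rfl
  rw [h2, h4] at h3
  rw [← wedge_coordForm_apply_basis y φ σ, h3]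
  rfl

end Hodge

/-! ### Endomorphisms acting on four-forms of a six-dimensional space. -/

section Derivation

variable {K U : Type*} [Field K] [AddCommGroup U] [Module K U]

/-- The action of an endomorphism on forms as a derivation,
`(x₁, …, xₖ) ↦ ∑ₐ Ω(x₁, …, f xₐ, …, xₖ)`. -/
def formDeriv {k : ℕ} (f : Module.End K U) (Ω : Form K U k) : Form K U k :=
  { ∑ a, Ω.toMultilinearMap.compLinearMap fun b => if b = a then f else LinearMap.id with
    map_eq_zero_of_eq' := by
      intro x i j hx hij
      have h (a : Fin k) : (fun b => (if b = a then f else LinearMap.id : Module.End K U) (x b)) =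
          Function.update x a (f (x a)) := by
        funext b
        by_cases hb : b = a
        · subst hb; simp
        · simp [hb]
      change (∑ a, Ω.toMultilinearMap.compLinearMap _) x = 0
      rw [_root_.sum_apply]
      simp only [MultilinearMap.compLinearMap_apply, h, AlternatingMap.coe_multilinearMap]
      rw [Finset.sum_eq_add i j hij]
      · have h2 : Function.update x j (f (x j)) =
            Function.update x i (f (x i)) ∘ Equiv.swap i j := by
          funext b
          by_cases hi : b = i
          · subst hi; simp [hij, hx, hij.symm]
          · by_cases hj : b = j
            · subst hj; simp [hx]
            · simp [hi, hj, Equiv.swap_apply_of_ne_of_ne]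
        rw [h2, Ω.map_swap _ hij, add_neg_cancel]
      · rintro c - ⟨hci, hcj⟩
        exact Ω.map_eq_zero_of_eq _ (by simp [hci.symm, hcj.symm, hx]) hij
      · simp
      · simp }

theorem formDeriv_apply {k : ℕ} (f : Module.End K U) (Ω : Form K U k) (x : Fin k → U) :
    formDeriv f Ω x = ∑ a, Ω (Function.update x a (f (x a))) := by
  have h (a : Fin k) : (fun b => (if b = a then f else LinearMap.id : Module.End K U) (x b)) =
      Function.update x a (f (x a)) := by
    funext b
    by_cases hb : b = a
    · subst hb; simp
    · simp [hb]
  change (∑ a, Ω.toMultilinearMap.compLinearMap _) x = _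
  rw [_root_.sum_apply]
  simp only [MultilinearMap.compLinearMap_apply, h, AlternatingMap.coe_multilinearMap]

/-- In dimension six a four-form is a bivector twisted by a volume form: its value on four basis
vectors is indexed by the omitted pair. The derivation becomes minus the action on bivectors plus a
trace term, and the trace vanishes. -/
theorem formDeriv_apply_perm (b : Module.Basis (Fin 6) K U) (f : Module.End K U)
    (Ω : Form K U 4) (B : Matrix (Fin 6) (Fin 6) K)
    (hΩ : ∀ σ : Equiv.Perm (Fin 6), (Ω fun a => b (σ (Fin.natAdd 2 a))) =
      ((Equiv.Perm.sign σ : ℤ) : K) * B (σ 0) (σ 1))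
    (hB : ∀ i, B i i = 0) (hf : LinearMap.trace K U f = 0) (σ : Equiv.Perm (Fin 6)) :
    (formDeriv f Ω fun a => b (σ (Fin.natAdd 2 a))) =
      -((Equiv.Perm.sign σ : ℤ) : K) * (LinearMap.toMatrix b b f * B +
        B * (LinearMap.toMatrix b b f).transpose) (σ 0) (σ 1) := by
  set M := LinearMap.toMatrix b b f with hM
  set x : Fin 4 → U := fun a => b (σ (Fin.natAdd 2 a)) with hx
  have hterm (c : Fin 4) : Ω (Function.update x c (f (x c))) =
      ((Equiv.Perm.sign σ : ℤ) : K) *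
        (M (σ (Fin.natAdd 2 c)) (σ (Fin.natAdd 2 c)) * B (σ 0) (σ 1)
        - M (σ 0) (σ (Fin.natAdd 2 c)) * B (σ (Fin.natAdd 2 c)) (σ 1)
        - M (σ 1) (σ (Fin.natAdd 2 c)) * B (σ 0) (σ (Fin.natAdd 2 c))) := by
    have h1 : f (x c) = ∑ k, M (σ k) (σ (Fin.natAdd 2 c)) • b (σ k) := by
      rw [Equiv.sum_comp σ fun i => M i (σ (Fin.natAdd 2 c)) • b i, hM]
      simp only [LinearMap.toMatrix_apply, hx]
      exact (b.sum_repr _).symm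
    rw [h1, AlternatingMap.map_update_sum]
    simp only [AlternatingMap.map_update_smul]
    -- A component of `f (x c)` along an omitted basis vector exchanges that vector with `x c`,
    -- which composes `σ` with a transposition.
    have hswap (k : Fin 6) (hk : k < 2) : Ω (Function.update x c (b (σ k))) =
        -((Equiv.Perm.sign σ : ℤ) : K) * B ((σ * Equiv.swap k (Fin.natAdd 2 c)) 0)
          ((σ * Equiv.swap k (Fin.natAdd 2 c)) 1) := by
      have hne : k ≠ Fin.natAdd 2 c := by
        intro h; rw [h] at hk; simp [Fin.lt_def] at hk; omega
      have h2 := hΩ (σ * Equiv.swap k (Fin.natAdd 2 c))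
      rw [Equiv.Perm.sign_mul, Equiv.Perm.sign_swap hne] at h2
      simp only [mul_neg, mul_one, Units.val_neg, Int.cast_neg] at h2
      rw [← h2]
      congr 1
      funext a
      by_cases ha : a = c
      · subst ha; simp
      · have h3 : Fin.natAdd 2 a ≠ k := by
          intro h; rw [← h] at hk; simp [Fin.lt_def] at hk; omega
        have h4 : Fin.natAdd 2 a ≠ Fin.natAdd 2 c := fun h => ha (Fin.natAdd_injective 4 2 h)
        simp [ha, hx, Equiv.swap_apply_of_ne_of_ne h3 h4]
    -- Along the vectors already present, only the diagonal entry avoids a repeated argument.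
    have hsame (d : Fin 4) : Ω (Function.update x c (b (σ (Fin.natAdd 2 d)))) =
        if d = c then ((Equiv.Perm.sign σ : ℤ) : K) * B (σ 0) (σ 1) else 0 := by
      split_ifs with h
      · subst h
        rw [← hΩ]
        congr 1
        exact Function.update_eq_self d x
      · exact Ω.map_eq_zero_of_eq _ (by simp [h, hx]) h
    have h0 := hswap 0 (by decide)
    have h1' := hswap 1 (by decide)
    have hc0 : (0 : Fin 6) ≠ Fin.natAdd 2 c := by
      intro h; have := congrArg Fin.val h; simp at this; omega
    have hc1 : (1 : Fin 6) ≠ Fin.natAdd 2 c := by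
      intro h; have := congrArg Fin.val h; simp at this; omega
    simp only [Equiv.Perm.mul_apply, Equiv.swap_apply_left,
      Equiv.swap_apply_of_ne_of_ne (show (1 : Fin 6) ≠ 0 by decide) hc1] at h0
    simp only [Equiv.Perm.mul_apply, Equiv.swap_apply_left,
      Equiv.swap_apply_of_ne_of_ne (show (0 : Fin 6) ≠ 1 by decide) hc0] at h1'
    have hsplit (F : Fin 6 → K) : ∑ k, F k = F 0 + F 1 + ∑ d : Fin 4, F (Fin.natAdd 2 d) := by
      rw [Fin.sum_univ_six, Fin.sum_univ_four]
      simp only [add_assoc]; rfl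
    rw [hsplit, h0, h1']
    simp only [hsame]
    simp
    ring
  have htr : ∑ k, M (σ k) (σ k) = 0 := by
    rw [Equiv.sum_comp σ fun i => M i i, ← hf, LinearMap.trace_eq_matrix_trace K b f]
    rfl
  have hMB : (M * B) (σ 0) (σ 1) = ∑ k, M (σ 0) (σ k) * B (σ k) (σ 1) := by
    rw [Equiv.sum_comp σ fun i => M (σ 0) i * B i (σ 1), Matrix.mul_apply]
  have hBM : (B * M.transpose) (σ 0) (σ 1) = ∑ k, B (σ 0) (σ k) * M (σ 1) (σ k) := by
    rw [Equiv.sum_comp σ fun i => B (σ 0) i * M (σ 1) i, Matrix.mul_apply]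
    rfl
  rw [formDeriv_apply, Finset.sum_congr rfl fun c _ => hterm c, ← Finset.mul_sum,
    Matrix.add_apply, hMB, hBM]
  rw [Fin.sum_univ_six] at htr ⊢
  rw [Fin.sum_univ_six, Fin.sum_univ_four]
  have e0 : (Fin.natAdd 2 (0 : Fin 4) : Fin 6) = 2 := rfl
  have e1 : (Fin.natAdd 2 (1 : Fin 4) : Fin 6) = 3 := rfl
  have e2 : (Fin.natAdd 2 (2 : Fin 4) : Fin 6) = 4 := rfl
  have e3 : (Fin.natAdd 2 (3 : Fin 4) : Fin 6) = 5 := rfl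
  rw [e0, e1, e2, e3, hB, hB]
  linear_combination ((Equiv.Perm.sign σ : ℤ) : K) * B (σ 0) (σ 1) * htr

/-- Every ordered pair of distinct indices is `(σ 0, σ 1)` for some `σ`, so all off-diagonal entries
are seen by the four-form; the diagonal vanishes because the matrix is skew. -/
theorem formDeriv_eq_zero_iff (b : Module.Basis (Fin 6) K U) (f : Module.End K U)
    (Ω : Form K U 4) (B : Matrix (Fin 6) (Fin 6) K)
    (hΩ : ∀ σ : Equiv.Perm (Fin 6), (Ω fun a => b (σ (Fin.natAdd 2 a))) =
      ((Equiv.Perm.sign σ : ℤ) : K) * B (σ 0) (σ 1))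
    (hB : ∀ i, B i i = 0) (hB' : B.transpose = -B) (hf : LinearMap.trace K U f = 0) :
    formDeriv f Ω = 0 ↔
      LinearMap.toMatrix b b f * B + B * (LinearMap.toMatrix b b f).transpose = 0 := by
  have h := formDeriv_apply_perm b f Ω B hΩ hB hf
  constructor
  · intro h0
    ext i j
    by_cases hij : i = j
    · subst hij
      rw [Matrix.add_apply, Matrix.mul_apply, Matrix.mul_apply, ← Finset.sum_add_distrib,
        Matrix.zero_apply]
      refine Finset.sum_eq_zero fun k _ => ?_
      have := congrFun (congrFun hB' i) k
      simp only [Matrix.transpose_apply, Matrix.neg_apply] at this ⊢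
      rw [this]; ring
    · obtain ⟨σ, h1, h2⟩ : ∃ σ : Equiv.Perm (Fin 6), σ 0 = i ∧ σ 1 = j := by
        refine ⟨Equiv.swap (Equiv.swap 0 i 1) j * Equiv.swap 0 i, ?_, ?_⟩
        · have h3 : i ≠ Equiv.swap 0 i 1 := by
            intro h3
            have h4 := congrArg (Equiv.swap 0 i) h3
            simp at h4
          simp [Equiv.swap_apply_of_ne_of_ne h3 hij]
        · simp
      have h3 := h σ
      rw [h0, h1, h2, AlternatingMap.zero_apply, eq_comm] at h3
      refine (mul_eq_zero.mp h3).resolve_left ?_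
      rcases Int.units_eq_one_or (Equiv.Perm.sign σ) with h4 | h4 <;> simp [h4]
  · intro h0
    refine b.ext_alternating fun I hI => ?_
    obtain ⟨σ, hσ⟩ : ∃ σ : Equiv.Perm (Fin 6), ∀ a : Fin 4, σ (Fin.natAdd 2 a) = I a := by
      have hinj : Function.Injective (Fin.natAdd 2 : Fin 4 → Fin 6) := fun a a' h =>
        Fin.natAdd_injective 4 2 h
      obtain ⟨σ, hσ⟩ := Equiv.Perm.exists_extending_pair (Fin.natAdd 2 : Fin 4 → Fin 6) I hinj hI
      exact ⟨σ, hσ⟩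
    have h3 := h σ
    simp only [hσ, h0] at h3
    simpa using h3

end Derivation

/-! ### Closed four-forms on a Lie algebra with an abelian ideal of codimension one. -/

section Closed

variable {K L : Type*} [Field K] [LieRing L] [LieAlgebra K L]

theorem lieDeriv_four (χ : Form K L 4) (X : Fin 5 → L) :
    lieDeriv χ X = -(χ ![⁅X 0, X 1⁆, X 2, X 3, X 4] - χ ![⁅X 0, X 2⁆, X 1, X 3, X 4]
      + χ ![⁅X 0, X 3⁆, X 1, X 2, X 4] - χ ![⁅X 0, X 4⁆, X 1, X 2, X 3]
      + χ ![⁅X 1, X 2⁆, X 0, X 3, X 4] - χ ![⁅X 1, X 3⁆, X 0, X 2, X 4]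
      + χ ![⁅X 1, X 4⁆, X 0, X 2, X 3] + χ ![⁅X 2, X 3⁆, X 0, X 1, X 4]
      - χ ![⁅X 2, X 4⁆, X 0, X 1, X 3] + χ ![⁅X 3, X 4⁆, X 0, X 1, X 2]) := by
  have h0 : Finset.Ici (0 : Fin 4) = {0, 1, 2, 3} := by decide
  have h1 : Finset.Ici (1 : Fin 4) = {1, 2, 3} := by decide
  have h2 : Finset.Ici (2 : Fin 4) = {2, 3} := by decide
  have h3 : Finset.Ici (3 : Fin 4) = {3} := by decide
  have hr (i j : Fin 4) (p q r : Fin 5) (hp : i.castSucc.succAbove (j.succAbove 0) = p)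
      (hq : i.castSucc.succAbove (j.succAbove 1) = q)
      (hr : i.castSucc.succAbove (j.succAbove 2) = r) :
      j.removeNth (i.castSucc.removeNth X) = ![X p, X q, X r] := by
    subst hp hq hr
    funext a
    fin_cases a <;> rfl
  rw [lieDeriv, Fin.sum_univ_four, h0, h1, h2, h3]
  rw [Finset.sum_insert (by decide), Finset.sum_insert (by decide), Finset.sum_insert (by decide),
    Finset.sum_singleton, Finset.sum_insert (by decide), Finset.sum_insert (by decide),
    Finset.sum_singleton, Finset.sum_insert (by decide), Finset.sum_singleton,
    Finset.sum_singleton]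
  rw [hr 0 0 2 3 4 (by decide) (by decide) (by decide),
    hr 0 1 1 3 4 (by decide) (by decide) (by decide),
    hr 0 2 1 2 4 (by decide) (by decide) (by decide),
    hr 0 3 1 2 3 (by decide) (by decide) (by decide),
    hr 1 1 0 3 4 (by decide) (by decide) (by decide),
    hr 1 2 0 2 4 (by decide) (by decide) (by decide),
    hr 1 3 0 2 3 (by decide) (by decide) (by decide),
    hr 2 2 0 1 4 (by decide) (by decide) (by decide),
    hr 2 3 0 1 3 (by decide) (by decide) (by decide),
    hr 3 3 0 1 2 (by decide) (by decide) (by decide)]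
  simp
  ring

/-- Exposes the linearity in each slot as linearity of maps, so that sums and multiples expand by
`simp`. -/
theorem form_four_eq_curryLeft (χ : Form K L 4) (a b c d : L) :
    χ ![a, b, c, d] = (((χ.curryLeft a).curryLeft b).curryLeft c).curryLeft d ![] := rfl

theorem form_four_swap_zero_one (χ : Form K L 4) (a b c d : L) :
    χ ![b, a, c, d] = -χ ![a, b, c, d] := by
  rw [← χ.map_swap ![a, b, c, d] (show (0 : Fin 4) ≠ 1 by decide)]
  congr 1
  funext i
  fin_cases i <;> rfl

theorem form_four_swap_one_two (χ : Form K L 4) (a b c d : L) :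
    χ ![a, c, b, d] = -χ ![a, b, c, d] := by
  rw [← χ.map_swap ![a, b, c, d] (show (1 : Fin 4) ≠ 2 by decide)]
  congr 1
  funext i
  fin_cases i <;> rfl

theorem form_four_swap_two_three (χ : Form K L 4) (a b c d : L) :
    χ ![a, b, d, c] = -χ ![a, b, c, d] := by
  rw [← χ.map_swap ![a, b, c, d] (show (2 : Fin 4) ≠ 3 by decide)]
  congr 1
  funext i
  fin_cases i <;> rfl

theorem formDeriv_four {U : Type*} [AddCommGroup U] [Module K U] (χ : Form K L 4)
    (ι : U →ₗ[K] L) (f : Module.End K U) (x : Fin 4 → U) :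
    formDeriv f (χ.compLinearMap ι) x =
      χ ![ι (f (x 0)), ι (x 1), ι (x 2), ι (x 3)] - χ ![ι (f (x 1)), ι (x 0), ι (x 2), ι (x 3)]
      + χ ![ι (f (x 2)), ι (x 0), ι (x 1), ι (x 3)]
      - χ ![ι (f (x 3)), ι (x 0), ι (x 1), ι (x 2)] := by
  have h (a : Fin 4) (p q r s : L)
      (h : (fun b => ι (Function.update x a (f (x a)) b)) = ![p, q, r, s]) :
      χ.compLinearMap ι (Function.update x a (f (x a))) = χ ![p, q, r, s] := by
    rw [← h]; rfl
  rw [formDeriv_apply, Fin.sum_univ_four,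
    h 0 (ι (f (x 0))) (ι (x 1)) (ι (x 2)) (ι (x 3)) (by funext b; fin_cases b <;> rfl),
    h 1 (ι (x 0)) (ι (f (x 1))) (ι (x 2)) (ι (x 3)) (by funext b; fin_cases b <;> rfl),
    h 2 (ι (x 0)) (ι (x 1)) (ι (f (x 2))) (ι (x 3)) (by funext b; fin_cases b <;> rfl),
    h 3 (ι (x 0)) (ι (x 1)) (ι (x 2)) (ι (f (x 3))) (by funext b; fin_cases b <;> rfl)]
  rw [form_four_swap_zero_one χ (ι (f (x 1))), form_four_swap_one_two χ _ (ι (f (x 2))),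
    form_four_swap_zero_one χ (ι (f (x 2))), form_four_swap_two_three χ _ _ (ι (f (x 3))),
    form_four_swap_one_two χ _ (ι (f (x 3))), form_four_swap_zero_one χ (ι (f (x 3)))]
  ring

/-- Brackets inside `u` vanish, so only brackets with `z` survive and they act through `f`. If one
argument is `z` and the others lie in `u`, the exterior derivative is, up to sign, the derivation
applied to the restriction. -/
theorem isClosedForm_iff_formDeriv_eq_zero {U : Type*} [AddCommGroup U] [Module K U]
    (χ : Form K L 4) (ι : U →ₗ[K] L) (f : Module.End K U) (z : L)
    (hz : ∀ x, ⁅z, ι x⁆ = ι (f x)) (hab : ∀ x y, ⁅ι x, ι y⁆ = 0)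
    (hL : ∀ X : L, ∃ (c : K) (x : U), X = c • z + ι x) :
    IsClosedForm χ ↔ formDeriv f (χ.compLinearMap ι) = 0 := by
  constructor
  · intro h
    ext x
    have h1 := h ![z, ι (x 0), ι (x 1), ι (x 2), ι (x 3)]
    have h0 (b c d : L) : χ ![0, b, c, d] = 0 := χ.map_coord_zero 0 rfl
    rw [lieDeriv_four] at h1
    simp [hz, hab, h0] at h1
    rw [formDeriv_four, AlternatingMap.zero_apply]
    linear_combination -h1
  · intro h X
    choose c x hX using hL
    have hb (i j : Fin 5) : ⁅X i, X j⁆ = c (X i) • ι (f (x (X j))) - c (X j) • ι (f (x (X i))) := by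
      conv_lhs => rw [hX (X i), hX (X j)]
      rw [lie_add, add_lie, add_lie, lie_smul, smul_lie, smul_lie, lie_smul, hab, hz, lie_self,
        ← lie_skew (ι (x (X i))) z, hz]
      module
    have hd (p q r s : U) : χ ![ι (f p), ι q, ι r, ι s] - χ ![ι (f q), ι p, ι r, ι s]
        + χ ![ι (f r), ι p, ι q, ι s] - χ ![ι (f s), ι p, ι q, ι r] = 0 := by
      have := formDeriv_four χ ι f ![p, q, r, s]
      rw [h] at this
      exact this.symm
    -- The terms with `z` in a later slot carry products `c (X i) * c (X k)` once the bracket is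
    -- expanded. They are antisymmetric in the pair and cancel in the full sum.
    have e (a : U) (i j k : Fin 5) : χ ![ι (f a), X i, X j, X k] =
        χ ![ι (f a), ι (x (X i)), ι (x (X j)), ι (x (X k))]
        + c (X i) * χ ![ι (f a), z, ι (x (X j)), ι (x (X k))]
        - c (X j) * χ ![ι (f a), z, ι (x (X i)), ι (x (X k))]
        + c (X k) * χ ![ι (f a), z, ι (x (X i)), ι (x (X j))] := by
      have z1 (a b : L) : χ ![a, z, z, b] = 0 :=
        χ.map_eq_zero_of_eq _ (i := 1) (j := 2) rfl (by decide)
      have z2 (a b : L) : χ ![a, z, b, z] = 0 :=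
        χ.map_eq_zero_of_eq _ (i := 1) (j := 3) rfl (by decide)
      have z3 (a b : L) : χ ![a, b, z, z] = 0 :=
        χ.map_eq_zero_of_eq _ (i := 2) (j := 3) rfl (by decide)
      have s1 := form_four_swap_one_two χ (ι (f a)) z (ι (x (X i))) (ι (x (X k)))
      have s2 := form_four_swap_two_three χ (ι (f a)) (ι (x (X i))) z (ι (x (X j)))
      have s3 := form_four_swap_one_two χ (ι (f a)) z (ι (x (X i))) (ι (x (X j)))
      conv_lhs => rw [hX (X i), hX (X j), hX (X k)]
      simp only [form_four_eq_curryLeft] at z1 z2 z3 s1 s2 s3 ⊢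
      simp only [map_add, map_smul, AlternatingMap.curryLeft_add, AlternatingMap.curryLeft_smul,
        LinearMap.add_apply, LinearMap.smul_apply, AlternatingMap.add_apply,
        AlternatingMap.smul_apply, z1, z2, z3, smul_eq_mul]
      rw [s1, s2, s3]
      ring
    have e2 (i j k l m : Fin 5) : χ ![⁅X i, X j⁆, X k, X l, X m] =
        c (X i) * χ ![ι (f (x (X j))), X k, X l, X m]
        - c (X j) * χ ![ι (f (x (X i))), X k, X l, X m] := by
      rw [hb, sub_eq_add_neg, ← neg_smul]
      simp only [form_four_eq_curryLeft, map_add, map_smul, AlternatingMap.curryLeft_add,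
        AlternatingMap.curryLeft_smul, LinearMap.add_apply, LinearMap.smul_apply,
        AlternatingMap.add_apply, AlternatingMap.smul_apply, smul_eq_mul]
      ring
    rw [lieDeriv_four]
    simp only [e2, e]
    have d0 := hd (x (X 1)) (x (X 2)) (x (X 3)) (x (X 4))
    have d1 := hd (x (X 0)) (x (X 2)) (x (X 3)) (x (X 4))
    have d2 := hd (x (X 0)) (x (X 1)) (x (X 3)) (x (X 4))
    have d3 := hd (x (X 0)) (x (X 1)) (x (X 2)) (x (X 4))
    have d4 := hd (x (X 0)) (x (X 1)) (x (X 2)) (x (X 3))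
    linear_combination -c (X 0) * d0 + c (X 1) * d1 - c (X 2) * d2 + c (X 3) * d3 - c (X 4) * d4

/-- The vector `y 0` is `g`-orthogonal to `u`, and contracting `φ` with it gives, up to `vol y`, the
bivector of the restriction of `χ` to `u`. Nilpotency enters through the vanishing trace. -/
theorem isClosedForm_iff_toMatrix [CharZero K] (u : Submodule K L) (f : Module.End K u) (z : L)
    (hz : ∀ x : u, ⁅z, (x : L)⁆ = f x) (hab : ∀ x y : u, ⁅(x : L), (y : L)⁆ = 0)
    (hf : IsNilpotent f) (b : Module.Basis (Fin 6) K u) (v y : Module.Basis (Fin 7) K L)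
    (hv0 : v 0 = z) (hv : ∀ i, v (Fin.succ i) = b i) {g : LinearMap.BilinForm K L}
    (hvy : ∀ i j, g (v i) (y j) = if i = j then 1 else 0) {vol : Form K L 7} (hvol : vol y ≠ 0)
    {φ : Form K L 3} {χ : Form K L 4} (hχ : IsHodgeDual g vol φ χ) :
    IsClosedForm χ ↔ LinearMap.toMatrix b b f *
        (Matrix.of fun i j : Fin 6 => φ ![y 0, y i.succ, y j.succ]) +
      (Matrix.of fun i j : Fin 6 => φ ![y 0, y i.succ, y j.succ]) *
        (LinearMap.toMatrix b b f).transpose = 0 := by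
  set B := Matrix.of fun i j : Fin 6 => φ ![y 0, y i.succ, y j.succ] with hB
  have hL (X : L) : ∃ (c : K) (x : u), X = c • z + u.subtype x := by
    refine ⟨v.repr X 0, ∑ i, v.repr X (Fin.succ i) • b i, ?_⟩
    conv_lhs => rw [← v.sum_repr X, Fin.sum_univ_succ]
    simp [hv0, hv]
  rw [isClosedForm_iff_formDeriv_eq_zero χ u.subtype f z (fun x => hz x) (fun x y => hab x y) hL]
  have hBd (i : Fin 6) : B i i = 0 := φ.map_eq_zero_of_eq _ (i := 1) (j := 2) rfl (by decide)
  have hBt : B.transpose = -B := by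
    ext i j
    rw [Matrix.transpose_apply, Matrix.neg_apply, hB, Matrix.of_apply, Matrix.of_apply,
      ← φ.map_swap ![y 0, y i.succ, y j.succ] (show (1 : Fin 3) ≠ 2 by decide)]
    congr 1
    funext a
    fin_cases a <;> rfl
  have key := formDeriv_eq_zero_iff b f (χ.compLinearMap u.subtype) ((vol y)⁻¹ • B) (fun σ => by
      -- The permutation of seven indices fixes `0` and acts as `σ` on the rest, so it has the same
      -- sign and keeps `y 0` among the three arguments of `φ`.
      have h := hχ.apply_basis hvy (Equiv.Perm.decomposeFin.symm (0, σ))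
      rw [Equiv.Perm.decomposeFin.symm_sign, if_pos rfl, one_mul] at h
      have h1 : (fun a : Fin 4 => v (Equiv.Perm.decomposeFin.symm (0, σ) (Fin.natAdd 3 a))) =
          fun a : Fin 4 => u.subtype (b (σ (Fin.natAdd 2 a))) := by
        funext a
        have : (Fin.natAdd 3 a : Fin 7) = Fin.succ (Fin.natAdd 2 a : Fin 6) := by
          ext; simp; omega
        rw [this, Equiv.Perm.decomposeFin_symm_apply_succ]
        simp [hv]
      have h2 : (fun a : Fin 3 => y (Equiv.Perm.decomposeFin.symm (0, σ) (Fin.castAdd 4 a))) =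
          ![y 0, y (σ 0).succ, y (σ 1).succ] := by
        funext a
        have hs (i : Fin 6) :
            y (Equiv.Perm.decomposeFin.symm (0, σ) i.succ) = y (σ i).succ := by simp
        fin_cases a
        · simp
        · exact hs 0
        · exact hs 1
      rw [h1, h2] at h
      change (χ fun a : Fin 4 => u.subtype (b (σ (Fin.natAdd 2 a)))) = _
      rw [Matrix.smul_apply, smul_eq_mul, hB, Matrix.of_apply]
      field_simp
      linear_combination h) (fun i => by simp [hBd])
      (by rw [Matrix.transpose_smul, hBt, smul_neg])
      (LinearMap.isNilpotent_trace_of_isNilpotent hf).eq_zero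
  rw [key, Matrix.mul_smul, Matrix.smul_mul, ← smul_add, smul_eq_zero_iff_right (inv_ne_zero hvol)]

end Closed

/-! ### Existence of Jordan bases for nilpotent endomorphisms. -/

section Jordan

open Polynomial

/-- The monomials form a basis of `K[X] / (X ^ k)`. -/
theorem exists_basis_quotient_X_pow (K : Type*) [Field K] (k : ℕ) :
    ∃ b : Module.Basis (Fin k) K (K[X] ⧸ (K[X] ∙ (X : K[X]) ^ k)),
      ∀ i, b i = Submodule.Quotient.mk (X ^ (i : ℕ)) := by
  have hm : ((X : K[X]) ^ k).Monic := monic_X_pow k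
  let E : AdjoinRoot ((X : K[X]) ^ k) ≃ₗ[K] (K[X] ⧸ (K[X] ∙ (X : K[X]) ^ k)) :=
    { toFun := fun x => x
      invFun := fun x => x
      left_inv := fun _ => rfl
      right_inv := fun _ => rfl
      map_add' := fun _ _ => rfl
      map_smul' := by rintro c ⟨p⟩; rfl }
  refine ⟨((AdjoinRoot.powerBasisAux' hm).map E).reindex (finCongr (natDegree_X_pow k)),
    fun i => ?_⟩
  rw [Module.Basis.reindex_apply, Module.Basis.map_apply]
  have h : AdjoinRoot.powerBasisAux' hm ((finCongr (natDegree_X_pow k)).symm i) =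
      AdjoinRoot.mk _ (X ^ (i : ℕ)) := by
    rw [← Module.Basis.repr_symm_single_one, AdjoinRoot.powerBasisAux'_repr_symm_apply]
    congr 1
    rw [Finset.sum_eq_single ((finCongr (natDegree_X_pow k)).symm i)]
    · simp [monomial_one_right_eq_X_pow]
    · intro j _ hj; rw [Finsupp.single_apply, if_neg (Ne.symm hj), monomial_zero_right]
    · simp
  rw [h]
  rfl

theorem dfinsupp_basis_apply {ι K : Type*} [DecidableEq ι] {M : ι → Type*} [Semiring K]
    [∀ i, AddCommMonoid (M i)] [∀ i, Module K (M i)] {η : ι → Type*}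
    (b : ∀ i, Module.Basis (η i) K (M i)) (i : ι) (j : η i) :
    DFinsupp.basis b ⟨i, j⟩ = DFinsupp.single i (b i j) := by
  rw [Module.Basis.apply_eq_iff, DFinsupp.basis]
  change (sigmaFinsuppLequivDFinsupp K).symm
    (DFinsupp.mapRange.linearEquiv (fun i => (b i).repr) (DFinsupp.single i (b i j))) = _
  rw [LinearEquiv.symm_apply_eq]
  change _ = sigmaFinsuppEquivDFinsupp (Finsupp.single ⟨i, j⟩ 1)
  rw [sigmaFinsuppEquivDFinsupp_single]
  simp

/-- A nilpotent endomorphism has a Jordan basis. -/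
theorem exists_jordan_basis {K U : Type*} [Field K] [AddCommGroup U] [Module K U]
    [Module.Finite K U] (f : Module.End K U) (hf : IsNilpotent f) :
    ∃ (d : ℕ) (n : Fin d → ℕ) (b : Module.Basis (Σ i, Fin (n i)) K U), ∀ i (j : Fin (n i)),
      f (b ⟨i, j⟩) = if h : (j : ℕ) + 1 < n i then b ⟨i, ⟨j + 1, h⟩⟩ else 0 := by
  classical
  obtain ⟨N, hN⟩ := hf
  -- Let `X` act as `f`. A power of `X` annihilates the module, so the structure theorem splits it
  -- into summands `K[X] / (X ^ n i)`, on which multiplication by `X` shifts the monomial basis.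
  have htor : Module.IsTorsion' (Module.AEval' f) (Submonoid.powers (X : K[X])) := by
    intro x
    refine ⟨⟨X ^ N, N, rfl⟩, ?_⟩
    obtain ⟨m, rfl⟩ := (Module.AEval'.of f).surjective x
    change (X ^ N : K[X]) • Module.AEval'.of f m = 0
    rw [Module.AEval'.X_pow_smul_of, hN]
    simp
  obtain ⟨d, n, ⟨e⟩⟩ := Module.torsion_by_prime_power_decomposition irreducible_X htor
  choose q hq using exists_basis_quotient_X_pow K
  let b₀ : Module.Basis (Σ i, Fin (n i)) K
      (Π₀ i : Fin d, K[X] ⧸ (K[X] ∙ (X : K[X]) ^ n i)) := DFinsupp.basis fun i => q (n i)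
  let e' : (Π₀ i : Fin d, K[X] ⧸ (K[X] ∙ (X : K[X]) ^ n i)) ≃ₗ[K] U :=
    (e.symm.restrictScalars K) ≪≫ₗ (Module.AEval'.of f).symm
  refine ⟨d, n, b₀.map e', fun i j => ?_⟩
  have hb (i : Fin d) (j : Fin (n i)) :
      b₀.map e' ⟨i, j⟩ = (Module.AEval'.of f).symm
        (e.symm (DFinsupp.single i (Submodule.Quotient.mk (X ^ (j : ℕ))))) := by
    rw [Module.Basis.map_apply, ← hq, dfinsupp_basis_apply]
    rfl
  have hX (y : Π₀ i : Fin d, K[X] ⧸ (K[X] ∙ (X : K[X]) ^ n i)) :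
      f ((Module.AEval'.of f).symm (e.symm y)) =
        (Module.AEval'.of f).symm (e.symm ((X : K[X]) • y)) := by
    rw [map_smul, Module.AEval'.of_symm_X_smul]
  rw [hb, hX, ← DFinsupp.single_smul, ← Submodule.Quotient.mk_smul, smul_eq_mul, ← pow_succ']
  split_ifs with h
  · rw [hb]
  · have h1 : (j : ℕ) + 1 = n i := by omega
    rw [h1, (Submodule.Quotient.mk_eq_zero _).mpr (Submodule.mem_span_singleton_self _),
      DFinsupp.single_zero, map_zero, map_zero]

end Jordan

/-! ### Reordering Jordan chains and integer matrices for them. -/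

section JordanBasis

variable {K U : Type*} [Field K] [AddCommGroup U] [Module K U]

/-- `b` is a Jordan basis of the nilpotent endomorphism `f`, with chains of lengths `n`. -/
def IsJordanBasis {ι : Type*} (f : Module.End K U) (n : ι → ℕ)
    (b : Module.Basis (Σ i, Fin (n i)) K U) : Prop :=
  ∀ i (j : Fin (n i)), f (b ⟨i, j⟩) = if h : (j : ℕ) + 1 < n i then b ⟨i, ⟨j + 1, h⟩⟩ else 0

/-- Chains may be permuted, and empty ones dropped, since they contribute no basis vectors. -/
theorem IsJordanBasis.comp {ι κ : Type*} {f : Module.End K U} {n : ι → ℕ}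
    {b : Module.Basis (Σ i, Fin (n i)) K U} (hb : IsJordanBasis f n b) {τ : κ → ι}
    (hτ : Function.Injective τ) (hn : ∀ i, 0 < n i → ∃ k, τ k = i) :
    ∃ b' : Module.Basis (Σ k, Fin (n (τ k))) K U, IsJordanBasis f (fun k => n (τ k)) b' := by
  let F : (Σ k, Fin (n (τ k))) → Σ i, Fin (n i) := fun s => ⟨τ s.1, s.2⟩
  have hF : Function.Bijective F := by
    constructor
    · rintro ⟨k, j⟩ ⟨k', j'⟩ h
      simp only [F, Sigma.mk.injEq] at h
      obtain ⟨h1, h2⟩ := h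
      obtain rfl := hτ h1
      rw [heq_iff_eq] at h2
      rw [h2]
    · rintro ⟨i, j⟩
      obtain ⟨k, rfl⟩ := hn i (by have := j.2; omega)
      exact ⟨⟨k, j⟩, rfl⟩
  refine ⟨b.reindex (Equiv.ofBijective F hF).symm, fun k j => ?_⟩
  simp only [Module.Basis.reindex_apply, Equiv.symm_symm, Equiv.ofBijective_apply, F]
  exact hb (τ k) j

theorem exists_isJordanBasis [Module.Finite K U] (f : Module.End K U) (hf : IsNilpotent f) :
    ∃ (d : ℕ) (n : Fin d → ℕ) (b : Module.Basis (Σ i, Fin (n i)) K U),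
      (∀ i, 0 < n i) ∧ IsJordanBasis f n b := by
  obtain ⟨d, n, b, hb⟩ := exists_jordan_basis f hf
  have hb : IsJordanBasis f n b := hb
  let ε := (Fintype.equivFin {i // 0 < n i}).symm
  obtain ⟨b', hb'⟩ := hb.comp (τ := fun k => (ε k : Fin d))
    (Subtype.val_injective.comp ε.injective) (fun i hi => ⟨ε.symm ⟨i, hi⟩, by simp⟩)
  exact ⟨_, _, b', fun k => (ε k).2, hb'⟩

/-- Sorting both families gives the same list; the permutation composes one sorting with the inverse
of the other. -/
theorem exists_perm_comp_eq {d : ℕ} {n m : Fin d → ℕ}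
    (h : Finset.univ.val.map n = Finset.univ.val.map m) : ∃ σ : Equiv.Perm (Fin d), n ∘ σ = m := by
  have hperm : (List.ofFn n).Perm (List.ofFn m) := by
    rw [← Multiset.coe_eq_coe]
    simpa [Fin.univ_def, List.ofFn_eq_map] using h
  have h1 := (((Tuple.sort n).ofFn_comp_perm n).trans hperm).trans
    ((Tuple.sort m).ofFn_comp_perm m).symm
  have h2 := List.ofFn_injective (h1.eq_of_pairwise' (Tuple.monotone_sort n).sortedLE_ofFn.pairwise
    (Tuple.monotone_sort m).sortedLE_ofFn.pairwise)
  refine ⟨(Tuple.sort m).symm.trans (Tuple.sort n), ?_⟩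
  funext i
  have := congrFun h2 ((Tuple.sort m).symm i)
  simpa using this

theorem IsJordanBasis.of_map_eq {d e : ℕ} {f : Module.End K U} {n : Fin d → ℕ} {m : Fin e → ℕ}
    {b : Module.Basis (Σ i, Fin (n i)) K U} (hb : IsJordanBasis f n b)
    (h : Finset.univ.val.map n = Finset.univ.val.map m) :
    ∃ b' : Module.Basis (Σ i, Fin (m i)) K U, IsJordanBasis f m b' := by
  have hd : d = e := by simpa using congrArg Multiset.card h
  subst hd
  obtain ⟨σ, rfl⟩ := exists_perm_comp_eq h
  exact hb.comp σ.injective fun i _ => ⟨σ.symm i, by simp⟩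

/-- The place of an entry of a table with two indices. -/
def tableEntry {N : ℕ} (T : List (List (Fin N)))
    (s : Σ i : Fin T.length, Fin (T.get i).length) : Fin N :=
  (T.get s.1).get s.2

/-- The matrix of the endomorphism moving each entry of the rows of a table to the next entry, and
the last one to zero. -/
def tableMatrix {N : ℕ} (T : List (List (Fin N))) : Matrix (Fin N) (Fin N) ℤ :=
  Matrix.of fun a c => if T.any fun l => (l.zip l.tail).contains (c, a) then 1 else 0

/-- `T` is a table containing each number exactly once. -/
def IsTable {N : ℕ} (T : List (List (Fin N))) : Prop :=
  Function.Bijective (tableEntry T) ∧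
    ∀ (i : Fin T.length) (j : Fin (T.get i).length) (a : Fin N),
      tableMatrix T a (tableEntry T ⟨i, j⟩) =
        if h : (j : ℕ) + 1 < (T.get i).length then
          (if tableEntry T ⟨i, ⟨j + 1, h⟩⟩ = a then 1 else 0) else 0

instance {N : ℕ} (T : List (List (Fin N))) : Decidable (IsTable T) := by
  unfold IsTable; infer_instance

/-- The table numbers the vectors of the chains freely. The numbering is chosen to suit a fixed
bivector, and the matrix of `f` becomes an explicit integer matrix. -/
theorem IsJordanBasis.exists_toMatrix_eq {d N : ℕ} {f : Module.End K U} {n : Fin d → ℕ}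
    {b : Module.Basis (Σ i, Fin (n i)) K U} (hb : IsJordanBasis f n b) {T : List (List (Fin N))}
    (hT : IsTable T) (h : Finset.univ.val.map n = (T.map List.length : List ℕ)) :
    ∃ w : Module.Basis (Fin N) K U,
      LinearMap.toMatrix w w f = (tableMatrix T).map (Int.castRingHom K) := by
  obtain ⟨b', hb'⟩ := hb.of_map_eq (m := fun i : Fin T.length => (T.get i).length) (by
    rw [h, Fin.univ_def]
    simp only [Multiset.map_coe, Multiset.coe_eq_coe]
    rw [show (fun i : Fin T.length => (T.get i).length) = List.length ∘ T.get from rfl,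
      ← List.map_map, ← List.ofFn_eq_map, List.ofFn_get])
  refine ⟨b'.reindex (Equiv.ofBijective _ hT.1), ?_⟩
  ext a c
  obtain ⟨⟨i, j⟩, rfl⟩ := hT.1.2 c
  have h1 : (b'.reindex (Equiv.ofBijective _ hT.1)) (tableEntry T ⟨i, j⟩) = b' ⟨i, j⟩ := by
    rw [Module.Basis.reindex_apply]
    congr 1
    exact (Equiv.ofBijective _ hT.1).symm_apply_apply ⟨i, j⟩
  rw [LinearMap.toMatrix_apply, h1, hb' i j, Matrix.map_apply, hT.2]
  split_ifs with h2 h3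
  · rw [← h3]
    simp
  · simp [h3]
  · simp

theorem partition_six (s : Multiset ℕ) (hs : ∀ i ∈ s, 0 < i) (hsum : s.sum = 6) :
    s = {6} ∨ s = {5, 1} ∨ s = {4, 2} ∨ s = {4, 1, 1} ∨ s = {3, 3} ∨ s = {3, 2, 1} ∨
      s = {3, 1, 1, 1} ∨ s = {2, 2, 2} ∨ s = {2, 2, 1, 1} ∨ s = {2, 1, 1, 1, 1} ∨
      s = {1, 1, 1, 1, 1, 1} := by
  obtain ⟨l, hl, rfl⟩ : ∃ l : List ℕ, l.Pairwise (· ≥ ·) ∧ (l : Multiset ℕ) = s :=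
    ⟨s.sort (· ≥ ·), s.pairwise_sort _, s.sort_eq _⟩
  rw [Multiset.sum_coe] at hsum
  simp only [Multiset.mem_coe] at hs
  rcases l with _ | ⟨a, _ | ⟨b, _ | ⟨c, _ | ⟨d, _ | ⟨e, _ | ⟨g, _ | ⟨h, l⟩⟩⟩⟩⟩⟩⟩ <;>
    simp only [List.pairwise_cons, List.mem_cons, forall_eq_or_imp, List.sum_cons, List.sum_nil,
      List.not_mem_nil] at hl hs hsum
  · omega
  · obtain rfl : a = 6 := by omega
    decide
  · obtain ⟨rfl, rfl⟩ | ⟨rfl, rfl⟩ | ⟨rfl, rfl⟩ :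
      (a = 5 ∧ b = 1) ∨ (a = 4 ∧ b = 2) ∨ (a = 3 ∧ b = 3) := by omega
    all_goals decide
  · obtain ⟨rfl, rfl, rfl⟩ | ⟨rfl, rfl, rfl⟩ | ⟨rfl, rfl, rfl⟩ :
      (a = 4 ∧ b = 1 ∧ c = 1) ∨ (a = 3 ∧ b = 2 ∧ c = 1) ∨ (a = 2 ∧ b = 2 ∧ c = 2) := by omega
    all_goals decide
  · obtain ⟨rfl, rfl, rfl, rfl⟩ | ⟨rfl, rfl, rfl, rfl⟩ :
      (a = 3 ∧ b = 1 ∧ c = 1 ∧ d = 1) ∨ (a = 2 ∧ b = 2 ∧ c = 1 ∧ d = 1) := by omega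
    all_goals decide
  · obtain ⟨rfl, rfl, rfl, rfl, rfl⟩ : a = 2 ∧ b = 1 ∧ c = 1 ∧ d = 1 ∧ e = 1 := by omega
    decide
  · obtain ⟨rfl, rfl, rfl, rfl, rfl, rfl⟩ :
      a = 1 ∧ b = 1 ∧ c = 1 ∧ d = 1 ∧ e = 1 ∧ g = 1 := by omega
    decide
  · omega

end JordanBasis

/-! ### Bivectors invariant under a nilpotent endomorphism. -/

section IntegerTables

variable {K V : Type*} [Field K] [AddCommGroup V] [Module K V]

/-- The value of `standardForm` on three vectors with given coordinates. -/
def standardValue (ε : ℤ) (x y z : Fin 7 → ℤ) : ℤ :=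
  ((standardTerms ε).map fun t => t.1 *
    (x t.2.1 * y t.2.2.1 * z t.2.2.2 - x t.2.1 * y t.2.2.2 * z t.2.2.1
      - x t.2.2.1 * y t.2.1 * z t.2.2.2 + x t.2.2.1 * y t.2.2.2 * z t.2.1
      + x t.2.2.2 * y t.2.1 * z t.2.2.1 - x t.2.2.2 * y t.2.2.1 * z t.2.1)).sum

theorem standardForm_apply (ε : ℤ) (e : Module.Basis (Fin 7) K V) {x y z : V}
    {X Y Z : Fin 7 → ℤ} (hx : ∀ i, e.repr x i = X i) (hy : ∀ i, e.repr y i = Y i)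
    (hz : ∀ i, e.repr z i = Z i) :
    standardForm (ε : K) e ![x, y, z] = (standardValue ε X Y Z : K) := by
  have h (a b c : Fin 7) : coordForm e ![a, b, c] ![x, y, z] =
      ((X a * Y b * Z c - X a * Y c * Z b - X b * Y a * Z c + X b * Y c * Z a
        + X c * Y a * Z b - X c * Y b * Z a : ℤ) : K) := by
    rw [coordForm_apply]
    simp [Matrix.det_fin_three, hx, hy, hz]
  simp only [standardForm, AlternatingMap.add_apply, AlternatingMap.sub_apply,
    AlternatingMap.smul_apply, h, standardValue, standardTerms, List.map_cons, List.map_nil,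
    List.sum_cons, List.sum_nil]
  push_cast
  simp only [smul_eq_mul]
  ring

theorem exists_basis_of_matrix {n : ℕ} (e : Module.Basis (Fin n) K V)
    {Y Z : Matrix (Fin n) (Fin n) ℤ} (h : Y * Z = 1) (h' : Z * Y = 1) :
    ∃ y : Module.Basis (Fin n) K V, (∀ i j, e.repr (y j) i = (Y i j : K)) ∧
      ∀ i j, y.repr (e j) i = (Z i j : K) := by
  have h1 : Y.map (Int.castRingHom K) * Z.map (Int.castRingHom K) = 1 := by
    rw [← Matrix.map_mul, h]; exact Matrix.map_one _ (map_zero _) (map_one _)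
  have h2 : Z.map (Int.castRingHom K) * Y.map (Int.castRingHom K) = 1 := by
    rw [← Matrix.map_mul, h']; exact Matrix.map_one _ (map_zero _) (map_one _)
  refine ⟨e.map (Matrix.toLinOfInv e e h1 h2), fun i j => ?_, fun i j => ?_⟩
  · rw [Module.Basis.map_apply]
    change e.repr (Matrix.toLin e e _ (e j)) i = _
    rw [Matrix.toLin_self]
    simp [Finsupp.single_apply]
  · rw [Module.Basis.map_repr]
    change e.repr (Matrix.toLin e e _ (e j)) i = _
    rw [Matrix.toLin_self]
    simp [Finsupp.single_apply]

/-- The bivector `w₀ ∧ w₁ + ⋯ + w₂ᵣ₋₂ ∧ w₂ᵣ₋₁` as a matrix. -/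
def pairingMatrix (r : ℕ) : Matrix (Fin 6) (Fin 6) ℤ :=
  Matrix.of fun i j =>
    if (i : ℕ) < 2 * r ∧ (i : ℕ) % 2 = 0 ∧ (j : ℕ) = i + 1 then 1
    else if (j : ℕ) < 2 * r ∧ (j : ℕ) % 2 = 0 ∧ (i : ℕ) = j + 1 then -1 else 0

theorem exists_basis_toMatrix_pairing {U : Type*} [AddCommGroup U] [Module K U] {d : ℕ}
    {f : Module.End K U} {n : Fin d → ℕ} {b : Module.Basis (Σ i, Fin (n i)) K U}
    (hb : IsJordanBasis f n b) {r : ℕ} (T : List (List (Fin 6))) (hT : IsTable T)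
    (h : Finset.univ.val.map n = (T.map List.length : List ℕ))
    (hr : tableMatrix T * pairingMatrix r + pairingMatrix r * (tableMatrix T).transpose = 0) :
    ∃ w : Module.Basis (Fin 6) K U,
      LinearMap.toMatrix w w f * (pairingMatrix r).map (Int.castRingHom K) +
        (pairingMatrix r).map (Int.castRingHom K) * (LinearMap.toMatrix w w f).transpose = 0 := by
  obtain ⟨w, hw⟩ := hb.exists_toMatrix_eq hT h
  refine ⟨w, ?_⟩
  rw [hw, ← Matrix.transpose_map, ← Matrix.map_mul, ← Matrix.map_mul,
    ← Matrix.map_add _ (map_add _), hr]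
  exact Matrix.map_zero _ (map_zero _)

theorem sum_sizes_of_isJordanBasis {U : Type*} [AddCommGroup U] [Module K U] {d : ℕ}
    {n : Fin d → ℕ} (b : Module.Basis (Σ i, Fin (n i)) K U) :
    (Finset.univ.val.map n).sum = Module.finrank K U := by
  rw [Module.finrank_eq_card_basis b, Fintype.card_sigma]
  simp [List.sum_ofFn]

/-- In each case `w₀, …, w₃` span an invariant subspace, made of tails of chains. A tail `0 → 1`
preserves `w₀ ∧ w₁`, a tail `0 → 3 → 2 → 1` preserves `w₀ ∧ w₁ + w₂ ∧ w₃`, and two vectors killed by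
`f` preserve their wedge product. -/
theorem exists_basis_toMatrix_pairing_two {U : Type*} [AddCommGroup U] [Module K U]
    (hU : Module.finrank K U = 6) {f : Module.End K U} (hf : IsNilpotent f) :
    ∃ w : Module.Basis (Fin 6) K U,
      LinearMap.toMatrix w w f * (pairingMatrix 2).map (Int.castRingHom K) +
        (pairingMatrix 2).map (Int.castRingHom K) * (LinearMap.toMatrix w w f).transpose = 0 := by
  have : Module.Finite K U := Module.finite_of_finrank_pos (by omega)
  obtain ⟨d, n, b, hn, hb⟩ := exists_isJordanBasis f hf
  have key := exists_basis_toMatrix_pairing hb (r := 2)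
  rcases partition_six _ (by simpa using hn) ((sum_sizes_of_isJordanBasis b).trans hU) with
    h | h | h | h | h | h | h | h | h | h | h <;> rw [h] at key
  · exact key [[4, 5, 0, 3, 2, 1]] (by decide +kernel) rfl (by decide +kernel)
  · exact key [[4, 0, 3, 2, 1], [5]] (by decide +kernel) rfl (by decide +kernel)
  · exact key [[0, 3, 2, 1], [4, 5]] (by decide +kernel) rfl (by decide +kernel)
  · exact key [[0, 3, 2, 1], [4], [5]] (by decide +kernel) rfl (by decide +kernel)
  · exact key [[4, 0, 1], [5, 2, 3]] (by decide +kernel) rfl (by decide +kernel)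
  · exact key [[4, 0, 1], [2, 3], [5]] (by decide +kernel) rfl (by decide +kernel)
  · exact key [[4, 0, 1], [2], [3], [5]] (by decide +kernel) rfl (by decide +kernel)
  · exact key [[0, 1], [2, 3], [4, 5]] (by decide +kernel) rfl (by decide +kernel)
  · exact key [[0, 1], [2, 3], [4], [5]] (by decide +kernel) rfl (by decide +kernel)
  · exact key [[0, 1], [2], [3], [4], [5]] (by decide +kernel) rfl (by decide +kernel)
  · exact key [[0], [1], [2], [3], [4], [5]] (by decide +kernel) rfl (by decide +kernel)

/-- A chain of even length carries an invariant non-degenerate bivector by itself, and two chains of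
equal odd length are paired with each other. The excluded partitions are those in which some odd
length is left unpaired. -/
theorem exists_basis_toMatrix_pairing_three {U : Type*} [AddCommGroup U] [Module K U]
    (hU : Module.finrank K U = 6) {f : Module.End K U} {d : ℕ} {n : Fin d → ℕ}
    {b : Module.Basis (Σ i, Fin (n i)) K U} (hn : ∀ i, 0 < n i) (hb : IsJordanBasis f n b)
    (h1 : Finset.univ.val.map n ≠ {5, 1}) (h2 : Finset.univ.val.map n ≠ {3, 2, 1})
    (h3 : Finset.univ.val.map n ≠ {3, 1, 1, 1}) :
    ∃ w : Module.Basis (Fin 6) K U,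
      LinearMap.toMatrix w w f * (pairingMatrix 3).map (Int.castRingHom K) +
        (pairingMatrix 3).map (Int.castRingHom K) * (LinearMap.toMatrix w w f).transpose = 0 := by
  have key := exists_basis_toMatrix_pairing hb (r := 3)
  rcases partition_six _ (by simpa using hn) ((sum_sizes_of_isJordanBasis b).trans hU) with
    h | h | h | h | h | h | h | h | h | h | h <;> rw [h] at key
  · exact key [[0, 3, 4, 5, 2, 1]] (by decide +kernel) rfl (by decide +kernel)
  · exact absurd h h1
  · exact key [[0, 3, 2, 1], [4, 5]] (by decide +kernel) rfl (by decide +kernel)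
  · exact key [[0, 3, 2, 1], [4], [5]] (by decide +kernel) rfl (by decide +kernel)
  · exact key [[0, 3, 4], [5, 2, 1]] (by decide +kernel) rfl (by decide +kernel)
  · exact absurd h h2
  · exact absurd h h3
  · exact key [[0, 1], [2, 3], [4, 5]] (by decide +kernel) rfl (by decide +kernel)
  · exact key [[0, 1], [2, 3], [4], [5]] (by decide +kernel) rfl (by decide +kernel)
  · exact key [[0, 1], [2], [3], [4], [5]] (by decide +kernel) rfl (by decide +kernel)
  · exact key [[0], [1], [2], [3], [4], [5]] (by decide +kernel) rfl (by decide +kernel)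

end IntegerTables

/-! ### Closed Hodge duals for `ε = -1`, with a null normal vector. -/

section LieIdeals

variable {K L : Type*} [Field K] [LieRing L] [LieAlgebra K L]

theorem exists_basis_fin_seven (u : Submodule K L) (hL : Module.finrank K L = 7) {z : L}
    (hz : z ∉ u) (w : Module.Basis (Fin 6) K u) :
    ∃ v : Module.Basis (Fin 7) K L, v 0 = z ∧ ∀ i, v (Fin.succ i) = w i := by
  have hli : LinearIndependent K (Fin.cons z fun i => (w i : L) : Fin 7 → L) := by
    rw [linearIndependent_finCons]
    refine ⟨w.linearIndependent.map' u.subtype u.ker_subtype, fun h => hz ?_⟩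
    refine Submodule.span_le.mpr ?_ h
    rintro _ ⟨i, rfl⟩
    exact (w i).2
  refine ⟨basisOfLinearIndependentOfCardEqFinrank hli (by simp [hL]), ?_, fun i => ?_⟩ <;> simp

theorem exists_closed_hodgeDual_neg_one [CharZero K] (u : Submodule K L)
    (hL : Module.finrank K L = 7) (hu : Module.finrank K u = 6) {z : L} (hzu : z ∉ u)
    (f : Module.End K u) (hz : ∀ x : u, ⁅z, (x : L)⁆ = f x)
    (hab : ∀ x y : u, ⁅(x : L), (y : L)⁆ = 0) (hf : IsNilpotent f) :
    ∃ (e : Module.Basis (Fin 7) K L) (χ : Form K L 4),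
      IsHodgeDual (diagForm ((-1 : ℤ) : K) e) (basisVolume e) (standardForm ((-1 : ℤ) : K) e) χ ∧
        IsClosedForm χ := by
  obtain ⟨w, hw⟩ := exists_basis_toMatrix_pairing_two hu hf
  obtain ⟨v, hv0, hv⟩ := exists_basis_fin_seven u hL hzu w
  -- The columns of `P = Q⁻¹` are the coordinates of `v` in the adapted basis `e`, and those of `Y =
  -- Z⁻¹` are the coordinates of the `g`-dual basis `y`. The normal vector `y 0 = e 0 + e 4` is
  -- null, and the entries are chosen so that contracting with it gives exactly `pairingMatrix 2`.
  let Q : Matrix (Fin 7) (Fin 7) ℤ := !![-1, 0, 0, 0, 1, 0, 0; 0, 0, 0, 0, 0, 1, 0;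
    0, 0, 0, 0, 0, 0, 1; 0, 0, -1, 0, 0, 0, 0; 0, 0, 0, 0, 1, 0, 0; 0, -1, 0, 0, 0, 1, 0;
    0, 0, 0, -1, 0, 0, -1]
  let P : Matrix (Fin 7) (Fin 7) ℤ := !![-1, 0, 0, 0, 1, 0, 0; 0, 1, 0, 0, 0, -1, 0;
    0, 0, 0, -1, 0, 0, 0; 0, 0, -1, 0, 0, 0, -1; 0, 0, 0, 0, 1, 0, 0; 0, 1, 0, 0, 0, 0, 0;
    0, 0, 1, 0, 0, 0, 0]
  let Y : Matrix (Fin 7) (Fin 7) ℤ := !![1, 0, 0, 0, 0, 0, 0; 0, 0, 0, 0, 0, 1, 0;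
    0, 0, 0, 1, 0, 0, 0; 0, 0, 0, 0, 0, 0, 1; 1, 0, 0, 0, 1, 0, 0; 0, 1, 0, 0, 0, 1, 0;
    0, 0, 1, 0, 0, 0, -1]
  let Z : Matrix (Fin 7) (Fin 7) ℤ := !![1, 0, 0, 0, 0, 0, 0; 0, -1, 0, 0, 0, 1, 0;
    0, 0, 0, 1, 0, 0, 1; 0, 0, 1, 0, 0, 0, 0; -1, 0, 0, 0, 1, 0, 0; 0, 1, 0, 0, 0, 0, 0;
    0, 0, 0, 1, 0, 0, 0]
  obtain ⟨e, -, hev⟩ := exists_basis_of_matrix v (Y := Q) (Z := P) (by decide +kernel)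
    (by decide +kernel)
  obtain ⟨y, hy, -⟩ := exists_basis_of_matrix e (Y := Y) (Z := Z) (by decide +kernel)
    (by decide +kernel)
  obtain ⟨χ, hχ⟩ := exists_isHodgeDual_diagForm (ε := ((-1 : ℤ) : K)) (by norm_num) e
    (standardForm ((-1 : ℤ) : K) e)
  refine ⟨e, χ, hχ, ?_⟩
  have hvy (i j : Fin 7) : diagForm ((-1 : ℤ) : K) e (v i) (y j) = if i = j then 1 else 0 := by
    have h : ∀ i j : Fin 7, ∑ k : Fin 7, (if (k : ℕ) < 4 then (-1 : ℤ) else 1) * (P k i * Y k j) =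
        if i = j then 1 else 0 := by decide +kernel
    have h2 := congrArg (Int.cast : ℤ → K) (h i j)
    rw [diagForm_apply]
    simp only [Module.Basis.coord_apply, hev, hy]
    push_cast at h2
    simpa using h2
  have hvol : basisVolume e y ≠ 0 := by
    intro h0
    have h1 := eq_smul_basisVolume y (basisVolume e)
    rw [h0, zero_smul] at h1
    have h2 := basisVolume_apply_self e
    rw [h1] at h2
    simp at h2
  rw [isClosedForm_iff_toMatrix u f z hz hab hf w v y hv0 hv hvy hvol hχ]
  have hB : (Matrix.of fun i j : Fin 6 =>
      standardForm ((-1 : ℤ) : K) e ![y 0, y i.succ, y j.succ]) =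
      (pairingMatrix 2).map (Int.castRingHom K) := by
    have h : (Matrix.of fun i j : Fin 6 => standardValue (-1) (fun k => Y k 0)
        (fun k => Y k i.succ) (fun k => Y k j.succ)) = pairingMatrix 2 := by decide +kernel
    ext i j
    rw [Matrix.of_apply, Matrix.map_apply, ← h, Matrix.of_apply,
      standardForm_apply (-1) e (fun k => hy k 0)
      (fun k => hy k i.succ) (fun k => hy k j.succ)]
    rfl
  rw [hB]
  exact hw

end LieIdeals

/-! ### Parity of the rank of skew matrices. -/

section EvenRank

variable {K : Type*} [Field K] [NeZero (2 : K)]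

theorem even_card_of_transpose_eq_neg {n : Type*} [Fintype n] [DecidableEq n] {A : Matrix n n K}
    (hA : A.transpose = -A) (hdet : A.det ≠ 0) : Even (Fintype.card n) := by
  by_contra hodd
  rw [Nat.not_even_iff_odd] at hodd
  have h := A.det_transpose
  rw [hA, Matrix.det_neg, hodd.neg_one_pow] at h
  have h2 : (2 : K) * A.det = 0 := by linear_combination -h
  exact (mul_ne_zero two_ne_zero hdet) h2

/-- On a complement of the kernel the skew form is non-degenerate, so its Gram matrix is an
invertible skew matrix whose size is the rank. -/
theorem even_rank_of_transpose_eq_neg {n : Type*} [Fintype n] [DecidableEq n] {A : Matrix n n K}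
    (hA : A.transpose = -A) : Even A.rank := by
  obtain ⟨C, hC⟩ := (LinearMap.ker A.mulVecLin).exists_isCompl
  have hrank : A.rank = Module.finrank K C := by
    have h1 := Submodule.finrank_add_eq_of_isCompl hC
    have h2 := LinearMap.finrank_range_add_finrank_ker A.mulVecLin
    rw [Matrix.rank]
    omega
  rw [hrank]
  let c := Module.finBasis K C
  let N : Matrix (Fin (Module.finrank K C)) (Fin (Module.finrank K C)) K :=
    Matrix.of fun i j => (c i : n → K) ⬝ᵥ A.mulVec (c j)
  have hswap (x y : n → K) : x ⬝ᵥ A.mulVec y = -(y ⬝ᵥ A.mulVec x) := by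
    rw [Matrix.dotProduct_mulVec, ← Matrix.mulVec_transpose, hA, Matrix.neg_mulVec,
      neg_dotProduct, dotProduct_comm]
  have hN : N.transpose = -N := by
    ext i j
    exact hswap _ _
  have hdet : N.det ≠ 0 := by
    intro h0
    obtain ⟨v, hv, hNv⟩ := Matrix.exists_mulVec_eq_zero_iff.mpr h0
    let x : C := ∑ j, v j • c j
    have hx0 : x = 0 := by
      have h1 (i) : (c i : n → K) ⬝ᵥ A.mulVec x = 0 := by
        have h2 := congrFun hNv i
        simp only [x, Submodule.coe_sum, Submodule.coe_smul, Matrix.mulVec_sum,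
          Matrix.mulVec_smul, dotProduct_sum, dotProduct_smul]
        simpa [N, Matrix.mulVec, dotProduct, mul_comm] using h2
      have h3 (y : C) : (y : n → K) ⬝ᵥ A.mulVec x = 0 := by
        rw [← c.sum_repr y]
        simp only [Submodule.coe_sum, Submodule.coe_smul, sum_dotProduct, smul_dotProduct, h1,
          smul_zero, Finset.sum_const_zero]
      have h4 : A.mulVec x = 0 := by
        refine dotProduct_eq_zero _ fun w => ?_
        obtain ⟨k, hk, y, hy, rfl⟩ := Submodule.mem_sup.mp
          (show w ∈ LinearMap.ker A.mulVecLin ⊔ C from hC.sup_eq_top ▸ Submodule.mem_top)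
        rw [dotProduct_comm, add_dotProduct, h3 ⟨y, hy⟩, hswap]
        have hk' : A.mulVec k = 0 := hk
        simp [hk']
      exact Subtype.ext (Submodule.disjoint_def.mp hC.disjoint x h4 x.2)
    exact hv (funext (Fintype.linearIndependent_iff.mp c.linearIndependent v hx0))
  simpa using even_card_of_transpose_eq_neg hN hdet

/-- The relation gives `M² B = -M B Mᵀ`, which is skew and has the same rank as `M²`. -/
theorem even_rank_sq {n : Type*} [Fintype n] [DecidableEq n] {M B : Matrix n n K}
    (hB : B.transpose = -B) (hdet : B.det ≠ 0) (h : M * B + B * M.transpose = 0) :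
    Even (M ^ 2).rank := by
  have h1 : M * B = -(B * M.transpose) := eq_neg_of_add_eq_zero_left h
  have h2 : M ^ 2 * B = -(M * B * M.transpose) := by
    rw [pow_two, Matrix.mul_assoc, Matrix.mul_assoc M B, ← Matrix.mul_neg, ← h1]
  have h3 : (M ^ 2 * B).transpose = -(M ^ 2 * B) := by
    rw [h2]
    simp [Matrix.transpose_mul, hB, Matrix.mul_assoc]
  rw [← Matrix.rank_mul_eq_left_of_isUnit_det B (M ^ 2) (isUnit_iff_ne_zero.mpr hdet)]
  exact even_rank_of_transpose_eq_neg h3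

end EvenRank

/-! ### Complex Jordan block sizes and the rank of the square. -/

section JordanBlocks

variable {W : Type*} [AddCommGroup W] [Module ℂ W] {m : ℕ} {μ : Fin m → ℂ} {n : Fin m → ℕ}

theorem toMatrix_eq_blockDiagonal_jordanBlock_iff {g : Module.End ℂ W}
    {b : Module.Basis (Σ i, Fin (n i)) ℂ W} :
    LinearMap.toMatrix b b g = Matrix.blockDiagonal' (fun i => jordanBlock (μ i) (n i)) ↔
      ∀ i (j : Fin (n i)), g (b ⟨i, j⟩) = μ i • b ⟨i, j⟩ +
        if 0 < (j : ℕ) then b ⟨i, ⟨j - 1, by omega⟩⟩ else 0 := by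
  have key (i) (j : Fin (n i)) (l) (k : Fin (n l)) :
      b.repr (μ i • b ⟨i, j⟩ + if 0 < (j : ℕ) then b ⟨i, ⟨j - 1, by omega⟩⟩ else 0) ⟨l, k⟩ =
        Matrix.blockDiagonal' (fun i => jordanBlock (μ i) (n i)) ⟨l, k⟩ ⟨i, j⟩ := by
    by_cases hli : l = i
    · subst hli
      rw [Matrix.blockDiagonal'_apply_eq]
      split_ifs with h0 <;>
        simp only [map_add, map_smul, Module.Basis.repr_self, jordanBlock, Matrix.of_apply,
          Finsupp.add_apply, Finsupp.smul_apply, Finsupp.single_apply, Sigma.mk.injEq, heq_eq_eq,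
          true_and, smul_eq_mul, Fin.ext_iff, map_zero, Finsupp.zero_apply] <;>
        split_ifs <;> first | omega | simp
    · rw [Matrix.blockDiagonal'_apply_ne _ _ _ hli]
      split_ifs with h0 <;>
        simp [Sigma.mk.injEq, Ne.symm hli]
  constructor
  · intro h i j
    refine b.ext_elem fun ⟨l, k⟩ => ?_
    rw [key, ← h, LinearMap.toMatrix_apply]
  · intro h
    ext ⟨l, k⟩ ⟨i, j⟩
    rw [← key, ← h, LinearMap.toMatrix_apply]

/-- Nilpotency forces all eigenvalues to vanish, and the square shifts each block by two places. A
block of size `n` thus contributes `n - 2`; truncated subtraction gives zero for sizes one and two.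
-/
theorem finrank_range_sq_of_toMatrix_eq {g : Module.End ℂ W} (hg : IsNilpotent g)
    {b : Module.Basis (Σ i, Fin (n i)) ℂ W}
    (h : LinearMap.toMatrix b b g = Matrix.blockDiagonal' fun i => jordanBlock (μ i) (n i)) :
    Module.finrank ℂ (LinearMap.range (g ^ 2)) = ((Finset.univ.val.map n).map (· - 2)).sum := by
  rw [toMatrix_eq_blockDiagonal_jordanBlock_iff] at h
  have hμ (i) (hi : 0 < n i) : μ i = 0 := by
    have h1 := h i ⟨0, hi⟩
    simp only [lt_irrefl, if_false, add_zero] at h1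
    have h2 (k : ℕ) : (g ^ k) (b ⟨i, ⟨0, hi⟩⟩) = μ i ^ k • b ⟨i, ⟨0, hi⟩⟩ := by
      induction k with
      | zero => simp
      | succ k ih => rw [pow_succ', Module.End.mul_apply, ih, map_smul, h1, smul_smul, pow_succ]
    obtain ⟨k, hk⟩ := hg
    have h3 := h2 k
    rw [hk, LinearMap.zero_apply, eq_comm, smul_eq_zero] at h3
    exact eq_zero_of_pow_eq_zero (h3.resolve_right (b.ne_zero _))
  have h' (i) (j : Fin (n i)) :
      g (b ⟨i, j⟩) = if 0 < (j : ℕ) then b ⟨i, ⟨j - 1, by omega⟩⟩ else 0 := by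
    rw [h, hμ i (by have := j.2; omega), zero_smul, zero_add]
  have hsq (i) (j : Fin (n i)) :
      (g ^ 2) (b ⟨i, j⟩) = if 1 < (j : ℕ) then b ⟨i, ⟨j - 2, by omega⟩⟩ else 0 := by
    rw [pow_two, Module.End.mul_apply, h']
    split_ifs with h0 h1 h1
    · rw [h', if_pos (by simpa using h1)]
      rfl
    · rw [h', if_neg (by simpa using h1)]
    · omega
    · simp
  let c : (Σ i, Fin (n i - 2)) → W := fun s => b ⟨s.1, s.2.castLE (by omega)⟩
  have hc : LinearIndependent ℂ c := by
    refine b.linearIndependent.comp (fun s : Σ i, Fin (n i - 2) =>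
      (⟨s.1, s.2.castLE (by omega)⟩ : Σ i, Fin (n i))) ?_
    rintro ⟨i, j⟩ ⟨k, l⟩ hs
    simp only [Sigma.mk.injEq] at hs
    obtain ⟨h1, h2⟩ := hs
    subst h1
    simpa [Fin.ext_iff] using h2
  have hr : LinearMap.range (g ^ 2) = Submodule.span ℂ (Set.range c) := by
    apply le_antisymm
    · rw [LinearMap.range_eq_map, ← b.span_eq, Submodule.map_span, Submodule.span_le]
      rintro _ ⟨_, ⟨⟨i, j⟩, rfl⟩, rfl⟩
      rw [hsq]
      split_ifs with h1
      · exact Submodule.subset_span ⟨⟨i, ⟨j - 2, by omega⟩⟩, rfl⟩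
      · exact Submodule.zero_mem _
    · rw [Submodule.span_le]
      rintro _ ⟨⟨i, j⟩, rfl⟩
      refine ⟨b ⟨i, ⟨j + 2, by omega⟩⟩, ?_⟩
      rw [hsq, if_pos (by simp)]
      rfl
  rw [hr, finrank_span_eq_card hc]
  simp [List.sum_ofFn]

theorem HasComplexJordanBlockSizes.finrank_range_sq {U : Type*} [AddCommGroup U] [Module ℝ U]
    {f : Module.End ℝ U} (hf : IsNilpotent f) {s : Multiset ℕ}
    (h : HasComplexJordanBlockSizes f s) :
    Module.finrank ℂ (LinearMap.range (f.baseChange ℂ ^ 2)) = (s.map (· - 2)).sum := by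
  obtain ⟨m, μ, n, b, -, rfl, hb⟩ := h
  refine finrank_range_sq_of_toMatrix_eq ?_ hb
  obtain ⟨k, hk⟩ := hf
  exact ⟨k, by rw [← LinearMap.baseChange_pow, hk, LinearMap.baseChange_zero]⟩

theorem IsJordanBasis.hasComplexJordanBlockSizes {U : Type*} [AddCommGroup U] [Module ℝ U]
    {f : Module.End ℝ U} {b : Module.Basis (Σ i, Fin (n i)) ℝ U} (hn : ∀ i, 0 < n i)
    (hb : IsJordanBasis f n b) : HasComplexJordanBlockSizes f (Finset.univ.val.map n) := by
  -- `IsJordanBasis` raises the position in a chain while `jordanBlock`, with ones above the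
  -- diagonal, lowers it, so each chain is reversed.
  let c := b.reindex (Equiv.sigmaCongrRight fun i => (Fin.revPerm : Equiv.Perm (Fin (n i))))
  have hc (i) (j : Fin (n i)) : c ⟨i, j⟩ = b ⟨i, j.rev⟩ := by
    simp [c]
  refine ⟨m, 0, n, Algebra.TensorProduct.basis ℂ c, hn, rfl, ?_⟩
  rw [toMatrix_eq_blockDiagonal_jordanBlock_iff]
  intro i j
  simp only [Algebra.TensorProduct.basis_apply, LinearMap.baseChange_tmul, hc, Pi.zero_apply,
    zero_smul, zero_add, hb i]
  by_cases h0 : 0 < (j : ℕ)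
  · rw [if_pos h0, dif_pos (by rw [Fin.val_rev]; omega)]
    congr 3
    simp only [Fin.ext_iff, Fin.val_rev]
    omega
  · rw [if_neg h0, dif_neg (by rw [Fin.val_rev]; omega), TensorProduct.tmul_zero]

/-- If `M B + B Mᵀ = 0` for the matrix `M` of a nilpotent `f` and an invertible skew-symmetric
matrix `B`, then `f ^ 2` has even rank. -/
theorem even_sum_of_hasComplexJordanBlockSizes {U : Type*} [AddCommGroup U] [Module ℝ U]
    {ι : Type*} [Fintype ι] [DecidableEq ι] (w : Module.Basis ι ℝ U)
    {f : Module.End ℝ U} (hf : IsNilpotent f) {s : Multiset ℕ}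
    (hs : HasComplexJordanBlockSizes f s) {B : Matrix ι ι ℝ} (hB : B.transpose = -B)
    (hdet : B.det ≠ 0)
    (h : LinearMap.toMatrix w w f * B + B * (LinearMap.toMatrix w w f).transpose = 0) :
    Even (s.map (· - 2)).sum := by
  rw [← hs.finrank_range_sq hf,
    ← Matrix.toLin_toMatrix (Algebra.TensorProduct.basis ℂ w) (Algebra.TensorProduct.basis ℂ w)
      (f.baseChange ℂ ^ 2), ← Matrix.rank_eq_finrank_range_toLin, pow_two,
    LinearMap.toMatrix_mul, ← pow_two, LinearMap.toMatrix_baseChange]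
  refine even_rank_sq (B := B.map (algebraMap ℝ ℂ)) ?_ ?_ ?_
  · rw [← Matrix.transpose_map, hB]
    ext i j
    simp
  · have := (algebraMap ℝ ℂ).map_det B
    rw [RingHom.mapMatrix_apply] at this
    rw [← this]
    simpa using hdet
  · rw [← Matrix.transpose_map, ← Matrix.map_mul, ← Matrix.map_mul,
      ← Matrix.map_add _ (map_add _), h]
    exact Matrix.map_zero _ (map_zero _)

end JordanBlocks

/-! ### Closed Hodge duals for `ε = 1`, and data from a Lie ideal. -/

section LieIdeals

variable {K L : Type*} [Field K] [LieRing L] [LieAlgebra K L]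

theorem exists_closed_hodgeDual_one [CharZero K] (u : Submodule K L)
    (hL : Module.finrank K L = 7) {z : L} (hzu : z ∉ u)
    (f : Module.End K u) (hz : ∀ x : u, ⁅z, (x : L)⁆ = f x)
    (hab : ∀ x y : u, ⁅(x : L), (y : L)⁆ = 0) (hf : IsNilpotent f) (w : Module.Basis (Fin 6) K u)
    (hw : LinearMap.toMatrix w w f * (pairingMatrix 3).map (Int.castRingHom K) +
        (pairingMatrix 3).map (Int.castRingHom K) * (LinearMap.toMatrix w w f).transpose = 0) :
    ∃ (e : Module.Basis (Fin 7) K L) (χ : Form K L 4),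
      IsHodgeDual (diagForm ((1 : ℤ) : K) e) (basisVolume e) (standardForm ((1 : ℤ) : K) e) χ ∧
        IsClosedForm χ := by
  obtain ⟨v, hv0, hv⟩ := exists_basis_fin_seven u hL hzu w
  -- The cyclic shift sends `v 0` to `e 6` and `v (i + 1)` to `e i`. Since `e_7 ⌟ φ = e^{12} +
  -- e^{34} + e^{56}`, the bivector is `pairingMatrix 3`; the basis `v` is orthonormal and so is its
  -- own dual.
  let σ : Equiv.Perm (Fin 7) := Equiv.subRight 1
  obtain ⟨e, he⟩ : ∃ e : Module.Basis (Fin 7) K L, ∀ i, v i = e (i - 1) :=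
    ⟨v.reindex σ, fun i => by simp [σ]⟩
  obtain ⟨χ, hχ⟩ := exists_isHodgeDual_diagForm (ε := ((1 : ℤ) : K)) (by norm_num) e
    (standardForm ((1 : ℤ) : K) e)
  refine ⟨e, χ, hχ, ?_⟩
  have hvy (i j : Fin 7) : diagForm ((1 : ℤ) : K) e (v i) (v j) = if i = j then 1 else 0 := by
    rw [he, he, diagForm_basis]
    simp
  have hvol : basisVolume e v ≠ 0 := by
    intro h0
    have h1 := eq_smul_basisVolume v (basisVolume e)
    rw [h0, zero_smul] at h1
    have h2 := basisVolume_apply_self e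
    rw [h1] at h2
    simp at h2
  rw [isClosedForm_iff_toMatrix u f z hz hab hf w v v hv0 hv hvy hvol hχ]
  have hB : (Matrix.of fun i j : Fin 6 =>
      standardForm ((1 : ℤ) : K) e ![v 0, v i.succ, v j.succ]) =
      (pairingMatrix 3).map (Int.castRingHom K) := by
    have h : (Matrix.of fun i j : Fin 6 => standardValue 1
        (fun k => if (0 : Fin 7) - 1 = k then 1 else 0)
        (fun k => if i.succ - 1 = k then 1 else 0)
        (fun k => if j.succ - 1 = k then 1 else 0)) = pairingMatrix 3 := by decide +kernel
    have hr (i k : Fin 7) : e.repr (v i) k = ((if i - 1 = k then 1 else 0 : ℤ) : K) := by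
      rw [he, Module.Basis.repr_self, Finsupp.single_apply]
      push_cast
      rfl
    ext i j
    rw [Matrix.of_apply, Matrix.map_apply, ← h, Matrix.of_apply,
      standardForm_apply 1 e (hr 0) (hr i.succ) (hr j.succ)]
    rfl
  rw [hB]
  exact hw

theorem exists_end_of_lieIdeal [LieRing.IsNilpotent L] (u : LieIdeal K L) [IsLieAbelian u] (z : L) :
    ∃ f : Module.End K u.toSubmodule, (∀ x : u.toSubmodule, ⁅z, (x : L)⁆ = f x) ∧
      IsNilpotent f ∧ ∀ x y : u.toSubmodule, ⁅(x : L), (y : L)⁆ = 0 := by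
  refine ⟨(LieAlgebra.ad K L z : L →ₗ[K] L).restrict (p := u.toSubmodule) (q := u.toSubmodule)
    fun _ hy => u.lie_mem hy, fun x => rfl, ?_, fun x y => ?_⟩
  · exact Module.End.isNilpotent.restrict _ (LieModule.isNilpotent_toEnd_of_isNilpotent K L L z)
  · exact congrArg (Subtype.val (p := (· ∈ u.toSubmodule))) (trivial_lie_zero u u x y)

theorem exists_notMem_of_finrank (u : Submodule K L) (hL : Module.finrank K L = 7)
    (hu : Module.finrank K u = 6) : ∃ z, z ∉ u := by
  by_contra! h
  rw [(Submodule.eq_top_iff' (p := u)).mpr h, finrank_top] at hu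
  omega

end LieIdeals

/-! ### Passing from `φ₋₁` to `φ₁` with a square root of `-1`. -/

section ComplexRescaling

variable {K V : Type*} [Field K] [AddCommGroup V] [Module K V]

theorem coordForm_eq_smul {E e : Module.Basis (Fin 7) K V} {c : Fin 7 → K}
    (h : ∀ i, E.coord i = c i • e.coord i) {k : ℕ} (I : Fin k → Fin 7) :
    coordForm E I = (∏ a, c (I a)) • coordForm e I := by
  ext x
  rw [AlternatingMap.smul_apply, coordForm_apply, coordForm_apply, smul_eq_mul,
    ← Matrix.det_mul_row]
  congr 1
  ext b a
  simp [h]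

theorem exists_standardForm_one_eq (e : Module.Basis (Fin 7) K V) {i : K} (hi : i * i = -1) :
    ∃ E : Module.Basis (Fin 7) K V, basisVolume E = basisVolume e ∧
      standardForm 1 E = standardForm (-1) e := by
  have hi0 : i ≠ 0 := by rintro rfl; simp at hi
  let j : Kˣ := Units.mk0 i hi0
  -- The factors on the indices `1, 2` and on `3, 4` multiply to `-1`, while every mixed pair
  -- multiplies to `1`, so only the two terms with `ε` change sign. The product of all seven factors
  -- is `1`.
  let c : Fin 7 → Kˣ := ![j, j, -j, -j, 1, 1, 1]
  have h (a) : (e.unitsSMul c⁻¹).coord a = (c a : K) • e.coord a := by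
    rw [Module.Basis.coord_unitsSMul, Pi.inv_apply, inv_inv]
    rfl
  refine ⟨e.unitsSMul c⁻¹, ?_, ?_⟩
  · rw [basisVolume, basisVolume, coordForm_eq_smul h]
    have : (∏ a : Fin 7, ((c (![0, 1, 2, 3, 4, 5, 6] a) : Kˣ) : K)) = 1 := by
      simp [Fin.prod_univ_succ, c, j]
      linear_combination (i * i - 1) * hi
    rw [this, one_smul]
  · simp only [standardForm, coordForm_eq_smul h]
    simp [Fin.prod_univ_succ, c, j, hi]

end ComplexRescaling

/-! ### Non-degeneracy of contractions of a `G₂`-form. -/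

section Positivity

variable {V : Type*} [AddCommGroup V] [Module ℝ V]

/-- The coefficients of `r` are the components of the seven-dimensional cross product of `p` and
`q`. -/
theorem standardForm_one_apply_coord {K V : Type*} [Field K] [AddCommGroup V] [Module K V]
    (e : Module.Basis (Fin 7) K V) (x y z : V) {p q r : Fin 7 → K}
    (hx : ∀ i, e.repr x i = p i) (hy : ∀ i, e.repr y i = q i) (hz : ∀ i, e.repr z i = r i) :
    standardForm 1 e ![x, y, z] =
      (p 1 * q 6 - p 6 * q 1 + (p 2 * q 4 - p 4 * q 2) - (p 3 * q 5 - p 5 * q 3)) * r 0 +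
      (-(p 0 * q 6 - p 6 * q 0) - (p 2 * q 5 - p 5 * q 2) - (p 3 * q 4 - p 4 * q 3)) * r 1 +
      (p 3 * q 6 - p 6 * q 3 - (p 0 * q 4 - p 4 * q 0) + (p 1 * q 5 - p 5 * q 1)) * r 2 +
      (-(p 2 * q 6 - p 6 * q 2) + (p 0 * q 5 - p 5 * q 0) + (p 1 * q 4 - p 4 * q 1)) * r 3 +
      (p 5 * q 6 - p 6 * q 5 + (p 0 * q 2 - p 2 * q 0) - (p 1 * q 3 - p 3 * q 1)) * r 4 +
      (-(p 4 * q 6 - p 6 * q 4) - (p 0 * q 3 - p 3 * q 0) - (p 1 * q 2 - p 2 * q 1)) * r 5 +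
      (p 0 * q 1 - p 1 * q 0 + (p 2 * q 3 - p 3 * q 2) + (p 4 * q 5 - p 5 * q 4)) * r 6 := by
  have h (a b c : Fin 7) : coordForm e ![a, b, c] ![x, y, z] =
      p a * q b * r c - p a * q c * r b - p b * q a * r c + p b * q c * r a
        + p c * q a * r b - p c * q b * r a := by
    rw [coordForm_apply]
    simp [Matrix.det_fin_three, hx, hy, hz]
  simp only [standardForm, AlternatingMap.add_apply, AlternatingMap.sub_apply,
    AlternatingMap.smul_apply, h, smul_eq_mul]
  ring

/-- The two-form `φ(n, ⬝, ⬝)` of a `G₂`-structure has kernel `ℝ n`. -/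
theorem exists_eq_smul_of_standardForm_eq_zero (e : Module.Basis (Fin 7) ℝ V) {n x : V}
    (hn : n ≠ 0) (h : ∀ y, standardForm 1 e ![n, x, y] = 0) : ∃ t : ℝ, x = t • n := by
  obtain ⟨p, hp⟩ : ∃ p : Fin 7 → ℝ, ∀ i, e.repr n i = p i := ⟨_, fun _ => rfl⟩
  obtain ⟨q, hq⟩ : ∃ q : Fin 7 → ℝ, ∀ i, e.repr x i = q i := ⟨_, fun _ => rfl⟩
  have hk (k : Fin 7) := standardForm_one_apply_coord e n x (e k) hp hq
    (r := fun i => if k = i then 1 else 0) (fun i => by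
      rw [Module.Basis.repr_self, Finsupp.single_apply])
  simp only [h] at hk
  have h0 := hk 0
  have h1 := hk 1
  have h2 := hk 2
  have h3 := hk 3
  have h4 := hk 4
  have h5 := hk 5
  have h6 := hk 6
  simp at h0 h1 h2 h3 h4 h5 h6
  set N := ∑ i, p i ^ 2 with hN
  set D := ∑ i, p i * q i with hD
  -- The cross product satisfies `|p × q|² = |p|² |q|² - (p · q)²`. Here it vanishes, which is the
  -- equality case of Cauchy–Schwarz, so `q` is proportional to `p`. Positivity of sums of squares
  -- is essential.
  have hsq : ∑ i, (N * q i - D * p i) ^ 2 = 0 := by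
    have : ∑ i, (N * q i - D * p i) ^ 2 = N * (N * ∑ i, q i ^ 2 - D ^ 2) := by
      simp only [hN, hD, Fin.sum_univ_seven]
      ring
    rw [this]
    have : N * ∑ i, q i ^ 2 - D ^ 2 = 0 := by
      simp only [hN, hD, Fin.sum_univ_seven]
      linear_combination -(p 1 * q 6 - p 6 * q 1 +
        (p 2 * q 4 - p 4 * q 2) - (p 3 * q 5 - p 5 * q 3)) * h0 -
      (-(p 0 * q 6 - p 6 * q 0) - (p 2 * q 5 - p 5 * q 2) - (p 3 * q 4 - p 4 * q 3)) * h1 -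
      (p 3 * q 6 - p 6 * q 3 - (p 0 * q 4 - p 4 * q 0) + (p 1 * q 5 - p 5 * q 1)) * h2 -
      (-(p 2 * q 6 - p 6 * q 2) + (p 0 * q 5 - p 5 * q 0) + (p 1 * q 4 - p 4 * q 1)) * h3 -
      (p 5 * q 6 - p 6 * q 5 + (p 0 * q 2 - p 2 * q 0) - (p 1 * q 3 - p 3 * q 1)) * h4 -
      (-(p 4 * q 6 - p 6 * q 4) - (p 0 * q 3 - p 3 * q 0) - (p 1 * q 2 - p 2 * q 1)) * h5 -
      (p 0 * q 1 - p 1 * q 0 + (p 2 * q 3 - p 3 * q 2) + (p 4 * q 5 - p 5 * q 4)) * h6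
    rw [this, mul_zero]
  have hN0 : N ≠ 0 := by
    intro hN0
    apply hn
    refine e.ext_elem fun i => ?_
    have := (Finset.sum_eq_zero_iff_of_nonneg fun i _ => sq_nonneg (p i)).mp hN0 i
      (Finset.mem_univ i)
    simpa [hp] using this
  refine ⟨D / N, e.ext_elem fun i => ?_⟩
  have := (Finset.sum_eq_zero_iff_of_nonneg fun i _ => sq_nonneg (N * q i - D * p i)).mp hsq i
    (Finset.mem_univ i)
  rw [map_smul, Finsupp.smul_apply, hp, hq, smul_eq_mul]
  field_simp
  linear_combination pow_eq_zero_iff (two_ne_zero) |>.mp this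

/-- A kernel vector gives a combination of `y 1, …, y 6` that annihilates `φ(y 0, ·, ·)`. It must be
a multiple of `y 0`, which linear independence rules out. -/
theorem det_ne_zero_of_standardForm (e y : Module.Basis (Fin 7) ℝ V) :
    (Matrix.of fun i j : Fin 6 => standardForm 1 e ![y 0, y i.succ, y j.succ]).det ≠ 0 := by
  intro h0
  obtain ⟨a, ha, hBa⟩ := Matrix.exists_mulVec_eq_zero_iff.mpr h0
  have halt (x z : V) : standardForm 1 e ![y 0, x, z] = -standardForm 1 e ![y 0, z, x] := by
    simp only [standardForm_one_apply_coord e _ _ _ (fun _ => rfl) (fun _ => rfl) (fun _ => rfl)]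
    ring
  have hlin (x : V) : standardForm 1 e ![y 0, x, ∑ j : Fin 6, a j • y j.succ] =
      ∑ j : Fin 6, a j * standardForm 1 e ![y 0, x, y j.succ] := by
    simp only [standardForm_one_apply_coord e _ _ _ (fun _ => rfl) (fun _ => rfl) (fun _ => rfl),
      Fin.sum_univ_six, map_add, map_smul, Finsupp.add_apply, Finsupp.smul_apply, smul_eq_mul]
    ring
  set x : V := ∑ j : Fin 6, a j • y j.succ with hx
  have h1 (i : Fin 7) : standardForm 1 e ![y 0, y i, x] = 0 := by
    refine Fin.cases ?_ (fun i => ?_) i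
    · have := standardForm_one_apply_coord e (y 0) (y 0) x (fun _ => rfl) (fun _ => rfl)
        (fun _ => rfl)
      rw [this]
      ring
    · rw [hlin]
      have := congrFun hBa i
      simpa [Matrix.mulVec, dotProduct, mul_comm] using this
  have h2 (z : V) : standardForm 1 e ![y 0, x, z] = 0 := by
    have hz : (AlternatingMap.curryLeft (standardForm 1 e) (y 0)).curryLeft x =
        (0 : V [⋀^Fin 1]→ₗ[ℝ] ℝ) := by
      refine Module.Basis.ext_alternating y fun w _ => ?_
      have h3 := h1 (w 0)
      rw [halt, neg_eq_zero] at h3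
      rw [AlternatingMap.curryLeft_apply_apply, AlternatingMap.curryLeft_apply_apply,
        AlternatingMap.zero_apply, ← h3]
      congr 1
      ext i
      fin_cases i <;> rfl
    have h4 := DFunLike.congr_fun hz ![z]
    rwa [AlternatingMap.curryLeft_apply_apply, AlternatingMap.curryLeft_apply_apply] at h4
  obtain ⟨t, ht⟩ := exists_eq_smul_of_standardForm_eq_zero e (y.ne_zero 0) h2
  apply ha
  ext j
  have h5 := congrArg (fun v => y.repr v j.succ) ht
  simpa [hx, Finsupp.single_apply, Fin.succ_ne_zero, (Fin.succ_ne_zero _).symm] using h5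

theorem nondegenerate_diagForm_one (e : Module.Basis (Fin 7) ℝ V) :
    (diagForm 1 e).Nondegenerate := by
  refine LinearMap.BilinForm.nondegenerate_of_det_ne_zero _ e ?_
  have : LinearMap.BilinForm.toMatrix e (diagForm 1 e) = 1 := by
    ext i j
    rw [LinearMap.BilinForm.toMatrix_apply, diagForm_basis, Matrix.one_apply]
    simp
  rw [this]
  simp

end Positivity

/-! ### Assembling the obstruction and the constructions. -/

theorem AdmitsCocalibratedG2.even_sum_sizes {L : Type*} [LieRing L]
    [LieAlgebra ℝ L] (u : Submodule ℝ L) (hL : Module.finrank ℝ L = 7)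
    (hu : Module.finrank ℝ u = 6) {z : L} (hzu : z ∉ u) (f : Module.End ℝ u)
    (hz : ∀ x : u, ⁅z, (x : L)⁆ = f x) (hab : ∀ x y : u, ⁅(x : L), (y : L)⁆ = 0)
    (hf : IsNilpotent f) (h : AdmitsCocalibratedG2 L) {s : Multiset ℕ}
    (hs : HasComplexJordanBlockSizes f s) : Even (s.map (· - 2)).sum := by
  obtain ⟨φ, g, vol, χ, ⟨e, he⟩, hg, hχ, hcl⟩ := h
  have hvol := hg.oriented e he
  have hge : g = diagForm 1 e := LinearMap.BilinForm.ext_basis e fun i j => by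
    rw [hg.orthonormal e he, diagForm_basis]
  have : Module.Finite ℝ u := Module.finite_of_finrank_pos (by omega)
  have w := Module.finBasisOfFinrankEq ℝ u hu
  obtain ⟨v, hv0, hv⟩ := exists_basis_fin_seven u hL hzu w
  have hnd := nondegenerate_diagForm_one e
  -- The given structure need not be adapted to `u`, so `y` is the metric dual of a basis that is.
  let y := LinearMap.BilinForm.dualBasis (diagForm 1 e) hnd v
  have hvy (i j : Fin 7) : g (v i) (y j) = if i = j then 1 else 0 := by
    rw [hge]
    refine LinearMap.BilinForm.apply_dualBasis_right hnd ⟨fun a b => ?_⟩ v i j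
    simp only [diagForm_apply, mul_comm]
  have hvoly : vol y ≠ 0 := by
    intro h0
    have h1 := eq_smul_basisVolume y vol
    rw [h0, zero_smul, hvol] at h1
    have h2 := basisVolume_apply_self e
    rw [h1] at h2
    simp at h2
  have key := (isClosedForm_iff_toMatrix u f z hz hab hf w v y hv0 hv hvy hvoly hχ).mp hcl
  refine even_sum_of_hasComplexJordanBlockSizes w hf hs (B := Matrix.of fun i j : Fin 6 =>
    φ ![y 0, y i.succ, y j.succ]) ?_ ?_ key
  · ext i j
    rw [Matrix.transpose_apply, Matrix.neg_apply, Matrix.of_apply, Matrix.of_apply]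
    have := φ.map_swap ![y 0, y i.succ, y j.succ] (i := 1) (j := 2) (by decide)
    rw [← this]
    congr 1
    ext k
    fin_cases k <;> rfl
  · have := det_ne_zero_of_standardForm e y
    have he' : φ = standardForm 1 e := he
    rwa [← he'] at this

theorem admitsCocalibratedG2_of_not_hasComplexJordanBlockSizes {L : Type*} [LieRing L]
    [LieAlgebra ℝ L] (u : Submodule ℝ L) (hL : Module.finrank ℝ L = 7)
    (hu : Module.finrank ℝ u = 6) {z : L} (hzu : z ∉ u) (f : Module.End ℝ u)
    (hz : ∀ x : u, ⁅z, (x : L)⁆ = f x) (hab : ∀ x y : u, ⁅(x : L), (y : L)⁆ = 0)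
    (hf : IsNilpotent f) (h1 : ¬ HasComplexJordanBlockSizes f {5, 1})
    (h2 : ¬ HasComplexJordanBlockSizes f {3, 2, 1})
    (h3 : ¬ HasComplexJordanBlockSizes f {3, 1, 1, 1}) : AdmitsCocalibratedG2 L := by
  have : Module.Finite ℝ u := Module.finite_of_finrank_pos (by omega)
  obtain ⟨d, n, b, hn, hb⟩ := exists_isJordanBasis f hf
  have hJ := hb.hasComplexJordanBlockSizes hn
  obtain ⟨w, hw⟩ := exists_basis_toMatrix_pairing_three hu hn hb
    (fun h => h1 (h ▸ hJ)) (fun h => h2 (h ▸ hJ)) (fun h => h3 (h ▸ hJ))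
  obtain ⟨e, χ, hχ, hcl⟩ := exists_closed_hodgeDual_one u hL hzu f hz hab hf w hw
  have hg := isInducedMetric_standardForm 1 (.inl rfl) e
  rw [Int.cast_one] at hg hχ
  exact ⟨_, _, _, χ, ⟨e, rfl⟩, hg, hχ, hcl⟩

theorem admitsCocalibratedG2Star_of_abelian {L : Type*} [LieRing L]
    [LieAlgebra ℝ L] (u : Submodule ℝ L) (hL : Module.finrank ℝ L = 7)
    (hu : Module.finrank ℝ u = 6) {z : L} (hzu : z ∉ u) (f : Module.End ℝ u)
    (hz : ∀ x : u, ⁅z, (x : L)⁆ = f x) (hab : ∀ x y : u, ⁅(x : L), (y : L)⁆ = 0)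
    (hf : IsNilpotent f) : AdmitsCocalibratedG2Star L := by
  obtain ⟨e, χ, hχ, hcl⟩ := exists_closed_hodgeDual_neg_one u hL hu hzu f hz hab hf
  have hg := isInducedMetric_standardForm (-1) (.inr rfl) e
  rw [Int.cast_neg, Int.cast_one] at hg hχ
  exact ⟨_, _, _, χ, ⟨e, rfl⟩, hg, hχ, hcl⟩

/-- Metric identity and Hodge dual involve only the three-form and the volume form. Both are
unchanged by the rescaled basis `E`, so the solution for `φ₋₁` carries over as it stands. -/
theorem admitsCocalibratedComplexG2_of_abelian {L : Type*} [LieRing L]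
    [LieAlgebra ℂ L] (u : Submodule ℂ L) (hL : Module.finrank ℂ L = 7)
    (hu : Module.finrank ℂ u = 6) {z : L} (hzu : z ∉ u) (f : Module.End ℂ u)
    (hz : ∀ x : u, ⁅z, (x : L)⁆ = f x) (hab : ∀ x y : u, ⁅(x : L), (y : L)⁆ = 0)
    (hf : IsNilpotent f) : AdmitsCocalibratedComplexG2 L := by
  obtain ⟨e, χ, hχ, hcl⟩ := exists_closed_hodgeDual_neg_one u hL hu hzu f hz hab hf
  have hg := metricIdentity_standardForm (K := ℂ) (-1) (.inr rfl) e
  rw [Int.cast_neg, Int.cast_one] at hg hχ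
  obtain ⟨E, hE1, hE2⟩ := exists_standardForm_one_eq e Complex.I_mul_I
  exact ⟨_, _, _, χ, ⟨E, hE1.symm, hE2.symm⟩, hg, hχ, hcl⟩

end CocalibratedG2

theorem mainTheorem9 :
    (∀ (L : Type*) [LieRing L] [LieAlgebra ℝ L] [LieRing.IsNilpotent L]
        (u : LieIdeal ℝ L) [IsLieAbelian u],
        Module.finrank ℝ L = 7 → Module.finrank ℝ u = 6 →
        (∀ e₇ : L, e₇ ∉ u →
          (CocalibratedG2.AdmitsCocalibratedG2 L ↔
            ¬ (CocalibratedG2.HasComplexJordanBlockSizes (CocalibratedG2.adOn u e₇) {5, 1} ∨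
              CocalibratedG2.HasComplexJordanBlockSizes (CocalibratedG2.adOn u e₇) {3, 2, 1} ∨
              CocalibratedG2.HasComplexJordanBlockSizes (CocalibratedG2.adOn u e₇)
                {3, 1, 1, 1}))) ∧
        CocalibratedG2.AdmitsCocalibratedG2Star L) ∧
    (∀ (L : Type*) [LieRing L] [LieAlgebra ℂ L] [LieRing.IsNilpotent L]
        (u : LieIdeal ℂ L) [IsLieAbelian u],
        Module.finrank ℂ L = 7 → Module.finrank ℂ u = 6 →
        CocalibratedG2.AdmitsCocalibratedComplexG2 L) := by
  refine ⟨fun L _ _ _ u _ hL hu => ⟨fun z hz => ?_, ?_⟩, fun L _ _ _ u _ hL hu => ?_⟩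
  · obtain ⟨f, hf, hnil, hab⟩ := CocalibratedG2.exists_end_of_lieIdeal u z
    have hfz : CocalibratedG2.adOn u z = f := LinearMap.ext fun x => Subtype.ext (hf x)
    rw [hfz]
    constructor
    · intro h hs
      have key (s : Multiset ℕ) (hs : CocalibratedG2.HasComplexJordanBlockSizes f s) :=
        h.even_sum_sizes u.toSubmodule hL hu hz f hf hab hnil hs
      rcases hs with hs | hs | hs
      -- The three sums of truncated differences are `3`, `1` and `1`, all odd.
      · exact absurd (key _ hs) (by decide)
      · exact absurd (key _ hs) (by decide)
      · exact absurd (key _ hs) (by decide)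
    · intro h
      rw [not_or, not_or] at h
      exact CocalibratedG2.admitsCocalibratedG2_of_not_hasComplexJordanBlockSizes
        u.toSubmodule hL hu hz f hf hab hnil h.1 h.2.1 h.2.2
  · obtain ⟨z, hz⟩ := CocalibratedG2.exists_notMem_of_finrank u.toSubmodule hL hu
    obtain ⟨f, hf, hnil, hab⟩ := CocalibratedG2.exists_end_of_lieIdeal u z
    exact CocalibratedG2.admitsCocalibratedG2Star_of_abelian u.toSubmodule hL hu hz f hf hab hnil
  · obtain ⟨z, hz⟩ := CocalibratedG2.exists_notMem_of_finrank u.toSubmodule hL hu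
    obtain ⟨f, hf, hnil, hab⟩ := CocalibratedG2.exists_end_of_lieIdeal u z
    exact CocalibratedG2.admitsCocalibratedComplexG2_of_abelian u.toSubmodule hL hu hz f hf hab hnil
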